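/- Let $C=\mathbb R+e\mathbb R$, $e^2=1$, be the algebra of para-complex numbers. Let $G$ be a para-complex Lie group of para-complex dimension $m$: a group that is a smooth $2m$-dimensional manifold with a para-complex structure $J$ (a smooth field of endomorphisms of the tangent spaces with $J^2=\mathrm{Id}$, $J\ne\pm\mathrm{Id}$, whose $\pm1$-eigendistributions have equal rank and are integrable), such that multiplication and inversion are para-holomorphic, i.e. smooth with differential commuting with the para-complex structures. Para-holomorphic coordinates $z^a=x^a+ey^a$ are diffeomorphisms $\psi=(z^1,\dots,z^m)$ from open sets of $G$ onto open sets of $C^m$ with $dz^a\circ J=e\,dz^a$. Put $\partial/\partial z^a=\frac12(\partial/\partial x^a+e\,\partial/\partial y^a)$ and $\partial/\partial z^{\bar a}=\frac12(\partial/\partial x^a-e\,\partial/\partial y^a)$. Repeated indices are summed from $1$ to $m$. Fix para-holomorphic coordinates $x=(x^1,\dots,x^m)$ near the identity, with the identity at $0$, in which the product reads $\phi^a(z,v)=z^a+v^a+A^a_{bc}z^bv^c+\dots$ up to second order. Put $C^a_{bc}=A^a_{bc}-A^a_{cb}$ and $C_{ab}=C^c_{ad}C^d_{bc}$. Let $\lambda^a=\lambda^a_b\,dz^b$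 be the right-invariant para-holomorphic $1$-forms on $G$ equal to $dx^a$ at the identity, i.e. in any para-holomorphic coordinates $(z^b)$ the value of $\lambda^a_b$ at $p$ is the derivative $\partial/\partial z^b$ at $q=p$ of $q\mapsto x^a(q\,p^{-1})$. Let $\widetilde\lambda$ be the inverse matrix of $(\lambda^a_b)$. The canonical torsion-free para-holomorphic connection on $G$ has the coefficients $$\Gamma^a_{bc}=\widetilde\lambda^a_d\Big(\frac{\partial\lambda^d_b}{\partial z^c}+\tfrac12C^d_{pq}\lambda^p_b\lambda^q_c\Big)=\tfrac12\widetilde\lambda^a_d\Big(\frac{\partial\lambda^d_b}{\partial z^c}+\frac{\partial\lambda^d_c}{\partial z^b}\Big).$$ (That the two expressions agree is part of the claim.) Its curvature is $$R^d_{c,ab}=\frac{\partial\Gamma^d_{cb}}{\partial z^a}-\frac{\partial\Gamma^d_{ca}}{\partial z^b}+\Gamma^f_{cb}\Gamma^d_{fa}-\Gamma^f_{ca}\Gamma^d_{fb}.$$ Let $g_{ab}=C_{pq}\lambda^p_a\lambda^q_b$ and $R_{abcd}=g_{df}R^f_{c,ab}$. **(1)** Let $Z,W$ be right-invariant para-holomorphic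 sections of $T^{1,0}G$. Suppose that they span a nondegenerate plane at some point of $G$, that is, $(g_{ac}g_{bd}-g_{ad}g_{bc})Z^aZ^cW^bW^d$ is invertible in $C$ there. Then they do so at every point of $G$, and the para-holomorphic sectional curvature $k(Z,W)$, defined by $$k(Z,W)\,(g_{ac}g_{bd}-g_{ad}g_{bc})Z^aZ^cW^bW^d=R_{abcd}Z^aZ^cW^bW^d,$$ is one and the same constant $k\in C$ at all points of $G$ (for all choices of the coordinates). **(2)** In all para-holomorphic coordinates the covariant derivatives of the curvature tensor vanish identically: for all $f,d,c,a,b$, $$\frac{\partial R^d_{c,ab}}{\partial z^f}+\Gamma^d_{kf}R^k_{c,ab}-\Gamma^k_{cf}R^d_{k,ab}-\Gamma^k_{af}R^d_{c,kb}-\Gamma^k_{bf}R^d_{c,ak}=0,\qquad \frac{\partial R^d_{c,ab}}{\partial z^{\bar f}}=0 .$$ (The second equation is the covariant derivative in the direction $\partial/\partial z^{\bar f}$, because the mixed coefficients of the connection vanish.) -/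

import Mathlib

open scoped Manifold ContDiff TensorProduct

noncomputable section

namespace ParaHol

/-! ### Para-complex numbers -/

/-- The algebra `C = ℝ + eℝ`, `e² = 1`, of para-complex numbers. -/
abbrev PC : Type := QuadraticAlgebra ℝ 1 0

/-- The para-complex unit, `e² = 1`. -/
def e : PC := ⟨0, 1⟩

/-- Para-complex multiplication is `(x₁ + e y₁)(x₂ + e y₂) = (x₁x₂ + y₁y₂) + e (x₁y₂ + y₁x₂)`. -/
theorem pc_mul (x₁ y₁ x₂ y₂ : ℝ) :
    (⟨x₁, y₁⟩ : PC) * ⟨x₂, y₂⟩ = ⟨x₁ * x₂ + y₁ * y₂, x₁ * y₂ + y₁ * x₂⟩ := by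
  ext <;> simp

theorem e_mul_e : e * e = 1 := by
  ext
  · simp [e, QuadraticAlgebra.re_one]
  · simp [e, QuadraticAlgebra.im_one]

/-- Real coordinates on `C`. -/
def pcCoords : PC →ₗ[ℝ] ℝ × ℝ where
  toFun z := (z.re, z.im)
  map_add' _ _ := rfl
  map_smul' _ _ := rfl

theorem pcCoords_injective : Function.Injective pcCoords := by
  intro z w h
  have h' : (z.re, z.im) = (w.re, w.im) := h
  ext
  · exact congrArg Prod.fst h'
  · exact congrArg Prod.snd h'

/-- `C` carries the norm, hence the smooth structure, of `ℝ × ℝ`. -/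
instance : NormedAddCommGroup PC :=
  NormedAddCommGroup.induced PC (ℝ × ℝ) pcCoords pcCoords_injective

instance : NormedSpace ℝ PC := NormedSpace.induced ℝ PC (ℝ × ℝ) pcCoords

/-- The space `C^m`. -/
abbrev PCn (m : ℕ) : Type := Fin m → PC

/-! ### Para-complex manifolds and para-holomorphic maps -/

section Manifolds

/-- A field of endomorphisms of the tangent spaces of `M`. -/
abbrev EndField {E : Type*} [NormedAddCommGroup E] [NormedSpace ℝ E]
    {H : Type*} [TopologicalSpace H] (I : ModelWithCorners ℝ E H)
    (M : Type*) [TopologicalSpace M] [ChartedSpace H M] : Type _ :=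
  ∀ p : M, TangentSpace I p →ₗ[ℝ] TangentSpace I p

/-- The standard para-complex structure of `C`: multiplication by `e`. -/
def stdC : EndField 𝓘(ℝ, PC) PC := fun _ => LinearMap.mulLeft ℝ e

/-- The standard para-complex structure of `C^m`: multiplication by `e`. -/
def stdCn (m : ℕ) : EndField 𝓘(ℝ, PCn m) (PCn m) := fun _ =>
  LinearMap.pi fun a => (LinearMap.mulLeft ℝ e).comp (LinearMap.proj a)

/-- The product of two endomorphism fields, on `M × N`. -/
def prodField
    {E : Type*} [NormedAddCommGroup E] [NormedSpace ℝ E]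
    {H : Type*} [TopologicalSpace H] {I : ModelWithCorners ℝ E H}
    {M : Type*} [TopologicalSpace M] [ChartedSpace H M] (J : EndField I M)
    {E' : Type*} [NormedAddCommGroup E'] [NormedSpace ℝ E']
    {H' : Type*} [TopologicalSpace H'] {I' : ModelWithCorners ℝ E' H'}
    {N : Type*} [TopologicalSpace N] [ChartedSpace H' N] (K : EndField I' N) :
    EndField (I.prod I') (M × N) := fun p => (J p.1).prodMap (K p.2)

/-- `f` is para-holomorphic on the (open) set `s`: it is smooth and `df ∘ J = K ∘ df` there. -/
structure ParaHolomorphicOn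
    {E : Type*} [NormedAddCommGroup E] [NormedSpace ℝ E]
    {H : Type*} [TopologicalSpace H] {I : ModelWithCorners ℝ E H}
    {M : Type*} [TopologicalSpace M] [ChartedSpace H M] (J : EndField I M)
    {E' : Type*} [NormedAddCommGroup E'] [NormedSpace ℝ E']
    {H' : Type*} [TopologicalSpace H'] {I' : ModelWithCorners ℝ E' H'}
    {N : Type*} [TopologicalSpace N] [ChartedSpace H' N] (K : EndField I' N)
    (f : M → N) (s : Set M) : Prop where
  smooth : ContMDiffOn I I' ∞ f s
  commutes : ∀ p ∈ s, ∀ v : TangentSpace I p, mfderiv I I' f p (J p v) = K (f p) (mfderiv I I' f p v)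

variable {E : Type*} [NormedAddCommGroup E] [NormedSpace ℝ E]
  {M : Type*} [TopologicalSpace M] [ChartedSpace E M]

/-- A distribution is integrable if near every point some smooth chart carries it to a field of
parallel subspaces. -/
def IsIntegrable (D : ∀ p : M, Submodule ℝ (TangentSpace 𝓘(ℝ, E) p)) : Prop :=
  ∀ p : M, ∃ ψ ∈ IsManifold.maximalAtlas 𝓘(ℝ, E) ∞ M, p ∈ ψ.source ∧
    ∃ F : Submodule ℝ E, ∀ q ∈ ψ.source,
      (D q).map (mfderiv 𝓘(ℝ, E) 𝓘(ℝ, E) ψ q).toLinearMap = F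

/-- `J` is a para-complex structure on `M`: a smooth field of endomorphisms with `J² = Id`,
`J ≠ ± Id`, whose eigenspaces for `1` and `-1` have the same dimension, and whose two
eigendistributions are integrable. -/
structure IsParaComplexStructure [IsManifold 𝓘(ℝ, E) ∞ M] (J : EndField 𝓘(ℝ, E) M) : Prop where
  smooth : ContMDiff 𝓘(ℝ, E).tangent 𝓘(ℝ, E).tangent ∞
    (fun v : TangentBundle 𝓘(ℝ, E) M => (⟨v.1, J v.1 v.2⟩ : TangentBundle 𝓘(ℝ, E) M))
  sq : ∀ p, (J p).comp (J p) = LinearMap.id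
  ne_id : ∀ p, J p ≠ LinearMap.id
  ne_neg_id : ∀ p, J p ≠ -LinearMap.id
  finrank_eq : ∀ p, Module.finrank ℝ (LinearMap.ker (LinearMap.id - J p)) =
    Module.finrank ℝ (LinearMap.ker (LinearMap.id + J p))
  integrable_pos : IsIntegrable fun p : M => LinearMap.ker (LinearMap.id - J p)
  integrable_neg : IsIntegrable fun p : M => LinearMap.ker (LinearMap.id + J p)

/-- `(M, J)` is a para-complex Lie group: `J` is a para-complex structure, and multiplication and
inversion are para-holomorphic maps. -/
structure IsParaComplexLieGroup [IsManifold 𝓘(ℝ, E) ∞ M] [Group M] (J : EndField 𝓘(ℝ, E) M) : Prop where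
  isParaComplex : IsParaComplexStructure J
  mul : ParaHolomorphicOn (prodField J J) J (fun p : M × M => p.1 * p.2) Set.univ
  inv : ParaHolomorphicOn J J (fun p : M => p⁻¹) Set.univ

/-- `ψ` is a para-holomorphic coordinate system of `(M, J)`, with values in `C^m`. -/
structure IsParaHolChart {m : ℕ} (J : EndField 𝓘(ℝ, E) M)
    (ψ : OpenPartialHomeomorph M (PCn m)) : Prop where
  toFun : ParaHolomorphicOn J (stdCn m) ψ ψ.source
  invFun : ParaHolomorphicOn (stdCn m) J ψ.symm ψ.target

/-! ### Para-complex tangent vectors -/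

/-- The para-complexified tangent space `T_{p,C} M`. -/
abbrev TC (p : M) : Type _ := PC ⊗[ℝ] TangentSpace 𝓘(ℝ, E) p

/-- The components `Z^a = dz^a(Z)` of a para-complex tangent vector with respect to `∂/∂z^a`, in the
chart `ψ = (z^1, …, z^m)`. -/
def components {m : ℕ} (ψ : OpenPartialHomeomorph M (PCn m)) {p : M} (Z : TC (E := E) p) : PCn m :=
  fun a => LinearMap.liftBaseChange PC ((LinearMap.proj (R := ℝ) (φ := fun _ : Fin m => PC) a).comp
    (mfderiv 𝓘(ℝ, E) 𝓘(ℝ, PCn m) ψ p).toLinearMap) Z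

/-- `Z` is a section of `T^{1,0} M`, the eigenbundle of `J` for the eigenvalue `e`, whose components
in para-holomorphic coordinates are para-holomorphic functions. -/
structure IsParaHolVectorField (m : ℕ) (J : EndField 𝓘(ℝ, E) M) (Z : ∀ p : M, TC (E := E) p) :
    Prop where
  type_one_zero : ∀ p, (J p).baseChange PC (Z p) = e • Z p
  paraHolomorphic : ∀ ψ : OpenPartialHomeomorph M (PCn m), IsParaHolChart J ψ → ∀ a,
    ParaHolomorphicOn J stdC (fun p => components ψ (Z p) a) ψ.source

/-- `Z` is invariant under the right translations of the group. -/
def IsRightInvariant [Group M] (Z : ∀ p : M, TC (E := E) p) : Prop :=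
  ∀ p h : M, (mfderiv 𝓘(ℝ, E) 𝓘(ℝ, E) (fun q : M => q * h) p :
    TangentSpace 𝓘(ℝ, E) p →ₗ[ℝ] TangentSpace 𝓘(ℝ, E) (p * h)).baseChange PC (Z p) = Z (p * h)

end Manifolds

/-! ### Coordinate expressions -/

section Coordinates

variable {m : ℕ}

/-- `∂f/∂z^a = ½ (∂f/∂x^a + e ∂f/∂y^a)`, where `z^a = x^a + e y^a`. -/
def dz (f : PCn m → PC) (a : Fin m) (w : PCn m) : PC :=
  (1 / 2 : ℝ) • (fderiv ℝ f w (Pi.single a 1) + e * fderiv ℝ f w (Pi.single a e))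

/-- `∂f/∂z̄^a = ½ (∂f/∂x^a - e ∂f/∂y^a)`. -/
def dzbar (f : PCn m → PC) (a : Fin m) (w : PCn m) : PC :=
  (1 / 2 : ℝ) • (fderiv ℝ f w (Pi.single a 1) - e * fderiv ℝ f w (Pi.single a e))

variable {G : Type*} [TopologicalSpace G] [Group G]

/-- The coordinates `φ^a(z, v)` of the product, in the chart `x` around the identity. -/
def groupLaw (x : OpenPartialHomeomorph G (PCn m)) (z v : PCn m) : PCn m :=
  x (x.symm z * x.symm v)

/-- The coefficient `A^a_{bc}` of `z^b v^c` in the expansion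
`φ^a(z, v) = z^a + v^a + A^a_{bc} z^b v^c + …`. -/
def secondOrder (x : OpenPartialHomeomorph G (PCn m)) (a b c : Fin m) : PC :=
  dz (fun z => dz (fun v => groupLaw x z v a) c 0) b 0

/-- The structure constants `C^a_{bc} = A^a_{bc} - A^a_{cb}`. -/
def structConst (x : OpenPartialHomeomorph G (PCn m)) (a b c : Fin m) : PC :=
  secondOrder x a b c - secondOrder x a c b

/-- The Cartan-Killing elements `C_{ab} = C^c_{ad} C^d_{bc}`. -/
def killing (x : OpenPartialHomeomorph G (PCn m)) (a b : Fin m) : PC :=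
  ∑ c, ∑ d, structConst x c a d * structConst x d b c

/-- The components `λ^a_b`, in the chart `ψ`, of the right-invariant para-holomorphic 1-forms `λ^a`
equal to `dx^a` at the identity: `λ^a_b(w)` is the derivative `∂/∂u^b`, at `u = w`, of the `a`-th
`x`-coordinate of `u · w⁻¹`, where points are named by their `ψ`-coordinates. -/
def lam (x ψ : OpenPartialHomeomorph G (PCn m)) (w : PCn m) : Matrix (Fin m) (Fin m) PC :=
  Matrix.of fun a b => dz (fun u => x (ψ.symm u * (ψ.symm w)⁻¹) a) b w

/-- The coefficients `Γ^a_{bc} = λ̃^a_d (∂λ^d_b/∂z^c + ½ C^d_{pq} λ^p_b λ^q_c)` of the connection, in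
the chart `ψ`, where `λ̃` is the inverse matrix of `λ`. -/
def Gam (x ψ : OpenPartialHomeomorph G (PCn m)) (a b c : Fin m) (w : PCn m) : PC :=
  ∑ d, (lam x ψ w)⁻¹ a d * (dz (fun u => lam x ψ u d b) c w +
    (1 / 2 : ℝ) • ∑ p, ∑ q, structConst x d p q * lam x ψ w p b * lam x ψ w q c)

/-- The symmetric expression `½ λ̃^a_d (∂λ^d_b/∂z^c + ∂λ^d_c/∂z^b)`. -/
def GamSymm (x ψ : OpenPartialHomeomorph G (PCn m)) (a b c : Fin m) (w : PCn m) : PC :=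
  (1 / 2 : ℝ) • ∑ d, (lam x ψ w)⁻¹ a d *
    (dz (fun u => lam x ψ u d b) c w + dz (fun u => lam x ψ u d c) b w)

/-- The curvature components
`R^d_{c,ab} = ∂Γ^d_{cb}/∂z^a - ∂Γ^d_{ca}/∂z^b + Γ^f_{cb} Γ^d_{fa} - Γ^f_{ca} Γ^d_{fb}`. -/
def curv (x ψ : OpenPartialHomeomorph G (PCn m)) (d c a b : Fin m) (w : PCn m) : PC :=
  dz (Gam x ψ d c b) a w - dz (Gam x ψ d c a) b w +
    ∑ f, (Gam x ψ f c b w * Gam x ψ d f a w - Gam x ψ f c a w * Gam x ψ d f b w)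

/-- The covariant derivative of `R^d_{c,ab}` in the direction `∂/∂z^f`. -/
def covDerivCurv (x ψ : OpenPartialHomeomorph G (PCn m)) (f d c a b : Fin m) (w : PCn m) : PC :=
  dz (curv x ψ d c a b) f w +
    ∑ k, (Gam x ψ d k f w * curv x ψ k c a b w - Gam x ψ k c f w * curv x ψ d k a b w
      - Gam x ψ k a f w * curv x ψ d c k b w - Gam x ψ k b f w * curv x ψ d c a k w)

/-- The covariant derivative of `R^d_{c,ab}` in the direction `∂/∂z̄^f`; as the connection is
para-holomorphic, its coefficients with mixed indices vanish. -/
def covDerivBarCurv (x ψ : OpenPartialHomeomorph G (PCn m)) (f d c a b : Fin m) (w : PCn m) : PC :=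
  dzbar (curv x ψ d c a b) f w

/-- The tensor `g_{ab} = C_{pq} λ^p_a λ^q_b`. -/
def metric (x ψ : OpenPartialHomeomorph G (PCn m)) (a b : Fin m) (w : PCn m) : PC :=
  ∑ p, ∑ q, killing x p q * lam x ψ w p a * lam x ψ w q b

/-- The curvature tensor `R_{abcd} = g_{df} R^f_{c,ab}` of type `(0,4)`. -/
def curv4 (x ψ : OpenPartialHomeomorph G (PCn m)) (a b c d : Fin m) (w : PCn m) : PC :=
  ∑ f, metric x ψ d f w * curv x ψ f c a b w

/-- `(g_{ac} g_{bd} - g_{ad} g_{bc}) Z^a Z^c W^b W^d`. -/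
def planeForm (x ψ : OpenPartialHomeomorph G (PCn m)) (w Z W : PCn m) : PC :=
  ∑ a, ∑ b, ∑ c, ∑ d, (metric x ψ a c w * metric x ψ b d w - metric x ψ a d w * metric x ψ b c w) *
    Z a * Z c * W b * W d

/-- `R_{abcd} Z^a Z^c W^b W^d`. -/
def curvForm (x ψ : OpenPartialHomeomorph G (PCn m)) (w Z W : PCn m) : PC :=
  ∑ a, ∑ b, ∑ c, ∑ d, curv4 x ψ a b c d w * Z a * Z c * W b * W d

variable {E : Type*} [NormedAddCommGroup E] [NormedSpace ℝ E] [ChartedSpace E G]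

/-- The plane spanned by `Z` and `W` is nondegenerate at `p`. As `C` has zero divisors, this means
that `(g_{ac} g_{bd} - g_{ad} g_{bc}) Z^a Z^c W^b W^d` is invertible. -/
def IsNondegenerateAt (x ψ : OpenPartialHomeomorph G (PCn m)) (Z W : ∀ p : G, TC (E := E) p)
    (p : G) : Prop :=
  IsUnit (planeForm x ψ (ψ p) (components ψ (Z p)) (components ψ (W p)))

/-- `k` is the para-holomorphic sectional curvature `k(Z, W)` at `p`:
`k (g_{ac} g_{bd} - g_{ad} g_{bc}) Z^a Z^c W^b W^d = R_{abcd} Z^a Z^c W^b W^d`. -/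
def IsSectionalCurvatureAt (x ψ : OpenPartialHomeomorph G (PCn m)) (Z W : ∀ p : G, TC (E := E) p)
    (p : G) (k : PC) : Prop :=
  k * planeForm x ψ (ψ p) (components ψ (Z p)) (components ψ (W p)) =
    curvForm x ψ (ψ p) (components ψ (Z p)) (components ψ (W p))

end Coordinates

end ParaHol

end

noncomputable section

namespace ParaHol

set_option linter.unusedSectionVars false

/-! ### Wirtinger operators on maps with values in a para-complex vector space -/

section Flat

variable {m : ℕ}
  {V : Type*} [NormedAddCommGroup V] [NormedSpace ℝ V] [Module PC V] [IsScalarTower ℝ PC V]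
  {V' : Type*} [NormedAddCommGroup V'] [NormedSpace ℝ V'] [Module PC V'] [IsScalarTower ℝ PC V']
  {V'' : Type*} [NormedAddCommGroup V''] [NormedSpace ℝ V''] [Module PC V''] [IsScalarTower ℝ PC V'']

/-! Everything is read through the right-invariant frame. Let $L_b$ be the $b$-th column of
$\lambda$, a function with values in the fixed space $C^m$, and let $[\cdot,\cdot]$ be the bracket
with the structure constants. The factorisation $pq^{-1}=(pr^{-1})(rq^{-1})$ of the right quotient,
differentiated twice on the diagonal, gives the Maurer–Cartan equations
$\partial_cL_b-\partial_bL_c=-[L_b,L_c]$ (`maurerCartan_lamCol`). Half of this equation is the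
difference of the two expressions for $\Gamma$, and its integrability condition is the Jacobi
identity (`IsCoframe.jacobi`).

In the frame the connection is $\lambda(\Gamma_{bc})=\partial_cL_b+\frac12[L_b,L_c]$, so the
curvature becomes $\lambda(R_{c,ab})=\frac14[L_c,[L_a,L_b]]$ (`IsCoframe.frameMap_curvVec`). Its
covariant derivative measures the failure of $[\cdot,L_f]$ to be a derivation of this double
bracket, and Jacobi makes it vanish (`IsCoframe.covDeriv_curvVec`).

A right-invariant field has the constant image $\lambda(Z)=Z(1)$ (`frameMap_components`). Both sides
of the equation for $k$ are therefore expressions in the bracket and the Killing form at the two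
vectors $Z(1)$, $W(1)$, with no dependence on the point (`planeForm_eq`, `curvForm_eq`). Another
chart at the identity changes them by a linear isomorphism that intertwines the brackets, hence
preserves the Killing form, which is a trace (`bracket_change`, `killingForm_change`). -/

theorem pc_smul_eq (z : PC) (v : V) : z • v = z.re • v + z.im • (e • v) := by
  have hz : z = z.re • (1 : PC) + z.im • e := by
    ext <;> simp [e, QuadraticAlgebra.re_one, QuadraticAlgebra.im_one]
  conv_lhs => rw [hz]
  rw [add_smul, smul_assoc, smul_assoc, one_smul]

theorem e_smul_e_smul (v : V) : e • (e • v) = v := by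
  rw [smul_smul, e_mul_e, one_smul]

/-- Scalar multiplication as a continuous real-linear map. -/
def smulL [FiniteDimensional ℝ V] (σ : PC) : V →L[ℝ] V :=
  LinearMap.toContinuousLinearMap (Algebra.lsmul ℝ ℝ V σ)

@[simp]
theorem smulL_apply [FiniteDimensional ℝ V] (σ : PC) (v : V) : smulL σ v = σ • v := rfl

/-- A para-complex bilinear map as a continuous real-bilinear map. -/
def bilinL [FiniteDimensional ℝ V] [FiniteDimensional ℝ V'] (B : V →ₗ[PC] V' →ₗ[PC] V'') :
    V →L[ℝ] V' →L[ℝ] V'' :=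
  LinearMap.toContinuousBilinearMap (B.restrictScalars₁₂ ℝ ℝ)

@[simp]
theorem bilinL_apply [FiniteDimensional ℝ V] [FiniteDimensional ℝ V']
    (B : V →ₗ[PC] V' →ₗ[PC] V'') (v : V) (v' : V') : bilinL B v v' = B v v' := rfl

/-- The operator `½ (∂/∂x^a + σ ∂/∂y^a)`. -/
def wirt (σ : PC) (F : PCn m → V) (a : Fin m) (w : PCn m) : V :=
  (1 / 2 : ℝ) • (fderiv ℝ F w (Pi.single a 1) + σ • fderiv ℝ F w (Pi.single a e))

theorem dz_eq_wirt (f : PCn m → PC) (a : Fin m) (w : PCn m) : dz f a w = wirt e f a w := rfl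

theorem dzbar_eq_wirt (f : PCn m → PC) (a : Fin m) (w : PCn m) :
    dzbar f a w = wirt (-e) f a w := by
  simp [dzbar, wirt, sub_eq_add_neg]

theorem wirt_congr {σ : PC} {F F' : PCn m → V} {a : Fin m} {w : PCn m}
    (h : F =ᶠ[nhds w] F') : wirt σ F a w = wirt σ F' a w := by
  simp only [wirt, h.fderiv_eq]

theorem wirt_add {σ : PC} {F F' : PCn m → V} {a : Fin m} {w : PCn m}
    (h : DifferentiableAt ℝ F w) (h' : DifferentiableAt ℝ F' w) :
    wirt σ (fun u => F u + F' u) a w = wirt σ F a w + wirt σ F' a w := by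
  simp only [wirt, fderiv_fun_add h h', add_apply, smul_add]
  abel

theorem wirt_sub {σ : PC} {F F' : PCn m → V} {a : Fin m} {w : PCn m}
    (h : DifferentiableAt ℝ F w) (h' : DifferentiableAt ℝ F' w) :
    wirt σ (fun u => F u - F' u) a w = wirt σ F a w - wirt σ F' a w := by
  simp only [wirt, fderiv_fun_sub h h', sub_apply, smul_sub, smul_add]
  abel

theorem wirt_sum {ι : Type*} {s : Finset ι} {σ : PC} {F : ι → PCn m → V} {a : Fin m} {w : PCn m}
    (h : ∀ i ∈ s, DifferentiableAt ℝ (F i) w) :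
    wirt σ (fun u => ∑ i ∈ s, F i u) a w = ∑ i ∈ s, wirt σ (F i) a w := by
  simp only [wirt, fderiv_fun_sum h, sum_apply, Finset.smul_sum,
    ← Finset.sum_add_distrib]

theorem wirt_bilin [FiniteDimensional ℝ V] [FiniteDimensional ℝ V'] (B : V →ₗ[PC] V' →ₗ[PC] V'')
    {σ : PC} {F : PCn m → V} {F' : PCn m → V'} {a : Fin m} {w : PCn m}
    (h : DifferentiableAt ℝ F w) (h' : DifferentiableAt ℝ F' w) :
    wirt σ (fun u => B (F u) (F' u)) a w = B (wirt σ F a w) (F' w) + B (F w) (wirt σ F' a w) := by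
  have key := (ContinuousLinearMap.hasFDerivAt_of_bilinear (bilinL B) h.hasFDerivAt
    h'.hasFDerivAt).fderiv
  simp only [bilinL_apply] at key
  have hR : ∀ u, ContinuousLinearMap.precompR (PCn m) (bilinL B) (F w) (fderiv ℝ F' w) u =
      B (F w) (fderiv ℝ F' w u) := fun _ => rfl
  simp only [wirt, key, add_apply, hR,
    ContinuousLinearMap.precompL_apply, bilinL_apply, map_add, LinearMap.add_apply, map_smul,
    LinearMap.smul_apply, smul_add, LinearMap.map_smul_of_tower]
  abel

theorem differentiableAt_bilin [FiniteDimensional ℝ V] [FiniteDimensional ℝ V']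
    (B : V →ₗ[PC] V' →ₗ[PC] V'') {F : PCn m → V} {F' : PCn m → V'} {w : PCn m}
    (h : DifferentiableAt ℝ F w) (h' : DifferentiableAt ℝ F' w) :
    DifferentiableAt ℝ (fun u => B (F u) (F' u)) w :=
  (ContinuousLinearMap.hasFDerivAt_of_bilinear (bilinL B) h.hasFDerivAt
    h'.hasFDerivAt).differentiableAt

theorem contDiffAt_bilin [FiniteDimensional ℝ V] [FiniteDimensional ℝ V']
    (B : V →ₗ[PC] V' →ₗ[PC] V'') {F : PCn m → V} {F' : PCn m → V'} {w : PCn m}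
    (h : ContDiffAt ℝ ∞ F w) (h' : ContDiffAt ℝ ∞ F' w) :
    ContDiffAt ℝ ∞ (fun u => B (F u) (F' u)) w :=
  ((bilinL B).contDiff.contDiffAt.comp w h).clm_apply h'

/-- Scalar multiplication as a bilinear map. -/
abbrev smulB : PC →ₗ[PC] V →ₗ[PC] V := LinearMap.lsmul PC V

theorem wirt_smul [FiniteDimensional ℝ V] {σ : PC} {f : PCn m → PC} {F : PCn m → V} {a : Fin m}
    {w : PCn m} (h : DifferentiableAt ℝ f w) (h' : DifferentiableAt ℝ F w) :
    wirt σ (fun u => f u • F u) a w = wirt σ f a w • F w + f w • wirt σ F a w :=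
  wirt_bilin smulB h h'

theorem differentiableAt_pc_smul [FiniteDimensional ℝ V] {f : PCn m → PC} {F : PCn m → V}
    {w : PCn m} (h : DifferentiableAt ℝ f w) (h' : DifferentiableAt ℝ F w) :
    DifferentiableAt ℝ (fun u => f u • F u) w :=
  differentiableAt_bilin smulB h h'

theorem contDiffAt_pc_smul [FiniteDimensional ℝ V] {f : PCn m → PC} {F : PCn m → V}
    {w : PCn m} (h : ContDiffAt ℝ ∞ f w) (h' : ContDiffAt ℝ ∞ F w) :
    ContDiffAt ℝ ∞ (fun u => f u • F u) w :=
  contDiffAt_bilin smulB h h'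

theorem wirt_apply {n : ℕ} {σ : PC} {F : PCn m → PCn n} {a : Fin m} {w : PCn m}
    (h : DifferentiableAt ℝ F w) (i : Fin n) :
    wirt σ F a w i = wirt σ (fun u => F u i) a w := by
  have : fderiv ℝ (fun u => F u i) w = (ContinuousLinearMap.proj i).comp (fderiv ℝ F w) :=
    (((ContinuousLinearMap.proj (R := ℝ) (φ := fun _ : Fin n => PC) i).hasFDerivAt).comp w
      h.hasFDerivAt).fderiv
  simp [wirt, this]

/-! ### Smoothness and symmetry of second derivatives -/

theorem contDiffAt_fderiv_apply {X Y : Type*} [NormedAddCommGroup X] [NormedSpace ℝ X]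
    [NormedAddCommGroup Y] [NormedSpace ℝ Y] {F : X → Y} {w : X}
    (h : ContDiffAt ℝ ∞ F w) (v : X) : ContDiffAt ℝ ∞ (fun u => fderiv ℝ F u v) w :=
  (h.fderiv_right (m := ∞) (by simp)).clm_apply contDiffAt_const

theorem contDiffAt_wirt [FiniteDimensional ℝ V] {σ : PC} {F : PCn m → V} {w : PCn m}
    (h : ContDiffAt ℝ ∞ F w) (a : Fin m) : ContDiffAt ℝ ∞ (wirt σ F a) w :=
  ContDiffAt.const_smul _ ((contDiffAt_fderiv_apply h _).add
    ((smulL (V := V) σ).contDiff.contDiffAt.comp w (contDiffAt_fderiv_apply h _)))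

theorem ne_infty : (∞ : WithTop ℕ∞) ≠ 0 := by simp

theorem fderiv_fderiv_apply {X Y : Type*} [NormedAddCommGroup X] [NormedSpace ℝ X]
    [NormedAddCommGroup Y] [NormedSpace ℝ Y] {F : X → Y} {w : X}
    (h : ContDiffAt ℝ ∞ F w) (v u : X) :
    fderiv ℝ (fun y => fderiv ℝ F y v) w u = fderiv ℝ (fderiv ℝ F) w u v := by
  have := (h.fderiv_right (m := ∞) (by simp)).differentiableAt ne_infty
  rw [fderiv_clm_apply this (by fun_prop)]
  simp

theorem fderiv_fderiv_symm {X Y : Type*} [NormedAddCommGroup X] [NormedSpace ℝ X]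
    [NormedAddCommGroup Y] [NormedSpace ℝ Y] {F : X → Y} {w : X}
    (h : ContDiffAt ℝ ∞ F w) (v u : X) :
    fderiv ℝ (fderiv ℝ F) w u v = fderiv ℝ (fderiv ℝ F) w v u :=
  (h.isSymmSndFDerivAt (by simpa using WithTop.coe_le_coe.2 (le_top (a := (2 : ℕ∞))))) u v

theorem wirt_wirt_comm [FiniteDimensional ℝ V] {σ τ : PC} {F : PCn m → V} {w : PCn m}
    (h : ContDiffAt ℝ ∞ F w) (a b : Fin m) :
    wirt σ (wirt τ F b) a w = wirt τ (wirt σ F a) b w := by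
  have key : ∀ (τ : PC) (b : Fin m) (u : PCn m), fderiv ℝ (wirt τ F b) w u =
      (1 / 2 : ℝ) • (fderiv ℝ (fderiv ℝ F) w u (Pi.single b 1) +
        τ • fderiv ℝ (fderiv ℝ F) w u (Pi.single b e)) := by
    intro τ b u
    have h1 := (contDiffAt_fderiv_apply h (Pi.single b 1)).differentiableAt ne_infty
    have h2 := (contDiffAt_fderiv_apply h (Pi.single b e)).differentiableAt ne_infty
    have h3 := ((smulL (V := V) τ).hasFDerivAt.comp w h2.hasFDerivAt)
    have h4 := ((h1.hasFDerivAt.add h3).const_smul (1 / 2 : ℝ)).fderiv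
    have h5 : fderiv ℝ (wirt τ F b) w = _ := h4
    rw [h5]
    simp [fderiv_fderiv_apply h]
  rw [wirt, wirt.eq_def τ (wirt σ F a)]
  simp only [key, fderiv_fderiv_symm h (Pi.single b _) (Pi.single a _)]
  simp only [smul_add, smul_comm σ (1 / 2 : ℝ), smul_comm τ (1 / 2 : ℝ), smul_comm σ τ]
  abel

/-- `F` is smooth near `w`, and its derivative at `w` commutes with multiplication by `e`. -/
structure PHolAt (F : V → V') (w : V) : Prop where
  smooth : ContDiffAt ℝ ∞ F w
  comm : ∀ u, fderiv ℝ F w (e • u) = e • fderiv ℝ F w u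

theorem map_pc_smul {A : V →L[ℝ] V'} (h : ∀ u, A (e • u) = e • A u) (z : PC) (u : V) :
    A (z • u) = z • A u := by
  rw [pc_smul_eq, map_add, map_smul, map_smul, h, ← pc_smul_eq]

theorem single_e_eq (a : Fin m) : (Pi.single a e : PCn m) = e • Pi.single a 1 := by
  ext i : 1
  by_cases h : i = a
  · subst h; simp
  · simp [h]

/-- By the para-Cauchy–Riemann equations $\partial_yF=e\,\partial_xF$; since $e^2=1$, the two halves
of the operator coincide. With the opposite sign they cancel. -/
theorem PHolAt.wirt_e {F : PCn m → V} {w : PCn m} (h : PHolAt F w) (a : Fin m) :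
    wirt e F a w = fderiv ℝ F w (Pi.single a 1) := by
  rw [wirt, single_e_eq, h.comm, e_smul_e_smul, ← two_smul ℝ, smul_smul]
  norm_num

theorem PHolAt.wirt_neg_e {F : PCn m → V} {w : PCn m} (h : PHolAt F w) (a : Fin m) :
    wirt (-e) F a w = 0 := by
  rw [wirt, single_e_eq, h.comm, neg_smul, e_smul_e_smul, add_neg_cancel, smul_zero]

theorem PHolAt.comp {G : V' → V''} {F : V → V'} {w : V} (hG : PHolAt G (F w)) (hF : PHolAt F w) :
    PHolAt (fun u => G (F u)) w where
  smooth := hG.smooth.comp w hF.smooth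
  comm u := by
    rw [fderiv_fun_comp w (hG.smooth.differentiableAt ne_infty)
      (hF.smooth.differentiableAt ne_infty)]
    simp [hF.comm, hG.comm]

/-- A para-complex linear map on `C^m` is determined by its values on the standard basis. -/
theorem sum_smul_apply_single {A : PCn m →L[ℝ] V} (h : ∀ u, A (e • u) = e • A u) (v : PCn m) :
    A v = ∑ a, v a • A (Pi.single a 1) := by
  conv_lhs => rw [pi_eq_sum_univ' v]
  rw [map_sum]
  exact Finset.sum_congr rfl fun a _ => map_pc_smul h _ _

/-- Second derivatives of a map which is para-holomorphic near `w` are para-complex bilinear. -/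
theorem fderiv_fderiv_smul_right [FiniteDimensional ℝ V'] {F : V → V'} {w : V}
    (h : ∀ᶠ u in nhds w, PHolAt F u) (z : PC) (u v : V) :
    fderiv ℝ (fderiv ℝ F) w u (z • v) = z • fderiv ℝ (fderiv ℝ F) w u v := by
  refine map_pc_smul (fun v => ?_) z v
  have hw := h.self_of_nhds.smooth
  rw [← fderiv_fderiv_apply hw, ← fderiv_fderiv_apply hw]
  have h1 : (fun y => fderiv ℝ F y (e • v)) =ᶠ[nhds w] fun y => smulL e (fderiv ℝ F y v) := by
    filter_upwards [h] with y hy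
    exact hy.comm v
  have h2 := (contDiffAt_fderiv_apply hw v).differentiableAt ne_infty
  have h3 := ((smulL (V := V') e).hasFDerivAt.comp w h2.hasFDerivAt).fderiv
  rw [h1.fderiv_eq]
  exact congrArg (fun A : V →L[ℝ] V' => A u) h3

theorem fderiv_fderiv_smul_left [FiniteDimensional ℝ V'] {F : V → V'} {w : V}
    (h : ∀ᶠ u in nhds w, PHolAt F u) (z : PC) (u v : V) :
    fderiv ℝ (fderiv ℝ F) w (z • u) v = z • fderiv ℝ (fderiv ℝ F) w u v := by
  have hw := h.self_of_nhds.smooth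
  rw [fderiv_fderiv_symm hw, fderiv_fderiv_smul_right h, fderiv_fderiv_symm hw]

end Flat

/-! ### Moving frames satisfying the Maurer–Cartan equations -/

section Frames

variable {m : ℕ}

/-- The linear map with columns `L k w`. -/
def frameMap (L : Fin m → PCn m → PCn m) (w : PCn m) : PCn m →ₗ[PC] PCn m :=
  Fintype.linearCombination PC (fun k => L k w)

theorem frameMap_apply (L : Fin m → PCn m → PCn m) (w X : PCn m) :
    frameMap L w X = ∑ k, X k • L k w :=
  Fintype.linearCombination_apply _ _ _

/-- The columns `L b` form on `U` a coframe with the structure equations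
`∂L_b/∂z^c - ∂L_c/∂z^b = -[L_b, L_c]`, where `B` is the bracket. -/
structure IsCoframe (U : Set (PCn m)) (B : PCn m →ₗ[PC] PCn m →ₗ[PC] PCn m)
    (L : Fin m → PCn m → PCn m) : Prop where
  isOpen : IsOpen U
  smooth : ∀ w ∈ U, ∀ b, ContDiffAt ℝ ∞ (L b) w
  maurerCartan : ∀ w ∈ U, ∀ b c, wirt e (L b) c w - wirt e (L c) b w = -B (L b w) (L c w)
  bar : ∀ w ∈ U, ∀ b c, wirt (-e) (L b) c w = 0
  injective : ∀ w ∈ U, Function.Injective (frameMap L w)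
  surjective : ∀ w ∈ U, Function.Surjective (frameMap L w)
  antisymm : ∀ u v, B u v = -B v u

variable {U : Set (PCn m)} {B : PCn m →ₗ[PC] PCn m →ₗ[PC] PCn m} {L : Fin m → PCn m → PCn m}

theorem contDiffAt_component {X : PCn m → PCn m} {w : PCn m} (h : ContDiffAt ℝ ∞ X w) (k : Fin m) :
    ContDiffAt ℝ ∞ (fun u => X u k) w :=
  contDiffAt_pi.1 h k

/-- `G b c` is the vector of the connection coefficients `Γ^k_{bc}`. -/
structure IsConnection (U : Set (PCn m)) (B : PCn m →ₗ[PC] PCn m →ₗ[PC] PCn m)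
    (L : Fin m → PCn m → PCn m) (G : Fin m → Fin m → PCn m → PCn m) : Prop where
  smooth : ∀ w ∈ U, ∀ b c, ContDiffAt ℝ ∞ (G b c) w
  frameMap_eq : ∀ w ∈ U, ∀ b c,
    frameMap L w (G b c w) = wirt e (L b) c w + (1 / 2 : ℝ) • B (L b w) (L c w)

/-- The vector of the curvature components `R^k_{c,ab}`. -/
def curvVec (G : Fin m → Fin m → PCn m → PCn m) (c a b : Fin m) (w : PCn m) :
    PCn m :=
  wirt e (G c b) a w - wirt e (G c a) b w +
    ∑ f, (G c b w f • G f a w - G c a w f • G f b w)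

/-! ### Jacobi identity, curvature and its covariant derivative from the structure equations -/

namespace IsCoframe

variable (h : IsCoframe U B L) {w : PCn m} (hw : w ∈ U)
include h hw

theorem differentiableAt (b : Fin m) : DifferentiableAt ℝ (L b) w :=
  (h.smooth w hw b).differentiableAt ne_infty

theorem wirt_frameMap {σ : PC} {X : PCn m → PCn m} (hX : DifferentiableAt ℝ X w) (a : Fin m) :
    wirt σ (fun u => frameMap L u (X u)) a w =
      frameMap L w (wirt σ X a w) + ∑ k, X w k • wirt σ (L k) a w := by
  have hXk : ∀ k, DifferentiableAt ℝ (fun u => X u k) w := differentiableAt_pi.1 hX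
  simp only [frameMap_apply]
  rw [wirt_sum fun k _ => differentiableAt_pc_smul (hXk k) (h.differentiableAt hw k),
    ← Finset.sum_add_distrib]
  refine Finset.sum_congr rfl fun k _ => ?_
  rw [wirt_smul (hXk k) (h.differentiableAt hw k), wirt_apply hX]

/-- The bracket satisfies the Jacobi identity, by the integrability of the structure equations. -/
theorem jacobi (u v z : PCn m) : B (B u v) z + B (B v z) u + B (B z u) v = 0 := by
  have hd : ∀ a b c, wirt e (wirt e (L b) c) a w - wirt e (wirt e (L c) b) a w =
      -(B (wirt e (L b) a w) (L c w) + B (L b w) (wirt e (L c) a w)) := by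
    intro a b c
    have hev : (fun u => wirt e (L b) c u - wirt e (L c) b u) =ᶠ[nhds w]
        fun u => (-B) (L b u) (L c u) := by
      filter_upwards [h.isOpen.mem_nhds hw] with u hu
      exact h.maurerCartan u hu b c
    have h1 := wirt_congr (σ := e) (a := a) hev
    rw [wirt_sub ((contDiffAt_wirt (h.smooth w hw b) c).differentiableAt ne_infty)
      ((contDiffAt_wirt (h.smooth w hw c) b).differentiableAt ne_infty),
      wirt_bilin _ (h.differentiableAt hw b) (h.differentiableAt hw c)] at h1
    rw [h1]
    simp only [LinearMap.neg_apply]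
    abel
  -- In the cyclic sum of the differentiated structure equations the second derivatives cancel in
  -- pairs. What remains is the Jacobi expression, once the structure equation is used to write each
  -- inner bracket as a difference of first derivatives.
  have hLLL : ∀ a b c, B (B (L a w) (L b w)) (L c w) + B (B (L b w) (L c w)) (L a w) +
      B (B (L c w) (L a w)) (L b w) = 0 := by
    intro a b c
    have comm := fun a b c => wirt_wirt_comm (σ := e) (τ := e) (h.smooth w hw a) b c
    have key : ∀ a b c, B (B (L a w) (L b w)) (L c w) =
        B (wirt e (L b) a w) (L c w) + B (L c w) (wirt e (L a) b w) := by
      intro a b c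
      have := h.maurerCartan w hw a b
      rw [h.antisymm (L c w), ← sub_eq_add_neg, ← LinearMap.sub_apply, ← map_sub,
        ← neg_sub, this, neg_neg]
    have e1 := hd a b c
    have e2 := hd b c a
    have e3 := hd c a b
    rw [comm b a c, comm c a b] at e1
    rw [comm a b c] at e2
    rw [key, key, key]
    linear_combination (norm := module) e1 + e2 + e3
  -- The identity is known on the frame only. It is extended by linearity in the first slot, and the
  -- cyclic symmetry `rot` brings each of the three arguments into that slot in turn.
  have lin : ∀ v z, (∀ k, B (B (L k w) v) z + B (B v z) (L k w) + B (B z (L k w)) v = 0) →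
      ∀ u, B (B u v) z + B (B v z) u + B (B z u) v = 0 := by
    intro v z hk u
    obtain ⟨X, rfl⟩ := h.surjective w hw u
    let f : PCn m →ₗ[PC] PCn m := (B.flip z) ∘ₗ (B.flip v) + B (B v z) + (B.flip v) ∘ₗ (B z)
    have hf : ∀ u, f u = B (B u v) z + B (B v z) u + B (B z u) v := fun _ => rfl
    rw [← hf, frameMap_apply, map_sum]
    refine Finset.sum_eq_zero fun k _ => ?_
    rw [map_smul, hf, hk, smul_zero]
  have rot : ∀ u v z, B (B u v) z + B (B v z) u + B (B z u) v = 0 →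
      B (B v z) u + B (B z u) v + B (B u v) z = 0 := by
    intro u v z hz
    rw [← hz]; abel
  have step₁ : ∀ b c u, _ := fun b c => lin (L b w) (L c w) fun a => hLLL a b c
  have step₂ : ∀ c u v, _ := fun c u => lin (L c w) u fun b => rot _ _ _ (step₁ b c u)
  exact rot _ _ _ (lin u v (fun c => rot _ _ _ (step₂ c u v)) z)

variable {G : Fin m → Fin m → PCn m → PCn m} (hG : IsConnection U B L G)
include hG

theorem contDiffAt_curvVec (c a b : Fin m) : ContDiffAt ℝ ∞ (curvVec G c a b) w := by
  have hs := hG.smooth w hw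
  refine ((contDiffAt_wirt (hs c b) a).sub (contDiffAt_wirt (hs c a) b)).add ?_
  refine ContDiffAt.sum fun f _ => ?_
  exact (contDiffAt_pc_smul (contDiffAt_component (hs c b) f) (hs f a)).sub
    (contDiffAt_pc_smul (contDiffAt_component (hs c a) f) (hs f b))

/-- Differentiate the frame form of the connection. Under antisymmetrisation in $a,b$ the second
derivatives of $L_c$ and the products with its first derivatives cancel. This leaves
$\frac12[L_c,\partial_aL_b-\partial_bL_a]+\frac14([[L_c,L_b],L_a]-[[L_c,L_a],L_b])$. The first term
is $\frac12[L_c,[L_a,L_b]]$ by Maurer–Cartan and the second is $-\frac14[L_c,[L_a,L_b]]$ by Jacobi.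
-/
theorem frameMap_curvVec (c a b : Fin m) :
    frameMap L w (curvVec G c a b w) = (1 / 4 : ℝ) • B (L c w) (B (L a w) (L b w)) := by
  have half : ∀ a b, frameMap L w (wirt e (G c b) a w) + ∑ f, G c b w f • frameMap L w (G f a w) =
      wirt e (wirt e (L c) b) a w + (1 / 2 : ℝ) • (B (wirt e (L c) a w) (L b w) +
        B (L c w) (wirt e (L b) a w)) +
        (1 / 2 : ℝ) • B (wirt e (L c) b w + (1 / 2 : ℝ) • B (L c w) (L b w)) (L a w) := by
    intro a b
    let B' : PCn m →ₗ[PC] PCn m →ₗ[PC] PCn m := (1 / 2 : ℝ) • B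
    have hev : (fun u => frameMap L u (G c b u)) =ᶠ[nhds w]
        fun u => wirt e (L c) b u + B' (L c u) (L b u) := by
      filter_upwards [h.isOpen.mem_nhds hw] with u hu
      exact hG.frameMap_eq u hu c b
    have h1 := wirt_congr (σ := e) (a := a) hev
    rw [h.wirt_frameMap hw ((hG.smooth w hw c b).differentiableAt ne_infty),
      wirt_add ((contDiffAt_wirt (h.smooth w hw c) b).differentiableAt ne_infty)
        (differentiableAt_bilin _ (h.differentiableAt hw c) (h.differentiableAt hw b)),
      wirt_bilin _ (h.differentiableAt hw c) (h.differentiableAt hw b)] at h1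
    -- The sum with $\partial_aL_f$ is exactly the Leibniz term that arises from differentiating the
    -- frame in $\lambda(\Gamma_{cb})$, so the quadratic terms in $\Gamma$ absorb it.
    have h2 : ∑ f, G c b w f • frameMap L w (G f a w) = ∑ f, G c b w f • wirt e (L f) a w +
        B' (frameMap L w (G c b w)) (L a w) := by
      rw [frameMap_apply, map_sum, LinearMap.sum_apply, ← Finset.sum_add_distrib]
      refine Finset.sum_congr rfl fun f _ => ?_
      rw [hG.frameMap_eq w hw f a, smul_add, map_smul, LinearMap.smul_apply]
      rfl
    rw [h2, ← add_assoc, h1, hG.frameMap_eq w hw c b, smul_add]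
    simp only [B', LinearMap.smul_apply]
  have hsplit : frameMap L w (curvVec G c a b w) =
      (frameMap L w (wirt e (G c b) a w) + ∑ f, G c b w f • frameMap L w (G f a w)) -
      (frameMap L w (wirt e (G c a) b w) + ∑ f, G c a w f • frameMap L w (G f b w)) := by
    simp only [curvVec, map_add, map_sub, map_sum, map_smul, Finset.sum_sub_distrib]
    abel
  rw [hsplit, half, half, wirt_wirt_comm (h.smooth w hw c) a b]
  have mc := congrArg (B (L c w)) (h.maurerCartan w hw a b)
  have jac := h.jacobi hw (L a w) (L b w) (L c w)
  have hR : ∀ r : ℝ, ∀ u v, B (r • u) v = r • B u v := fun r u v => by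
    rw [LinearMap.map_smul_of_tower]; rfl
  rw [h.antisymm (B (L a w) (L b w))] at jac
  have a1 : B (L c w) (L b w) = - B (L b w) (L c w) := h.antisymm _ _
  simp only [map_add, LinearMap.add_apply, hR, map_sub, map_neg, a1, LinearMap.neg_apply] at mc jac ⊢
  linear_combination (norm := module) (-1 / 2 : ℝ) • mc + (-1 / 4 : ℝ) • jac

theorem wirt_eq (b c : Fin m) :
    wirt e (L b) c w = frameMap L w (G b c w) - (1 / 2 : ℝ) • B (L b w) (L c w) := by
  rw [hG.frameMap_eq w hw b c]; abel

/-- Apply the frame and differentiate $\frac14[L_c,[L_a,L_b]]$ using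
$\partial_fL_k=\lambda(\Gamma_{kf})-\frac12[L_k,L_f]$. The terms in $\lambda(\Gamma)$ are those of
the covariant derivative. The rest is $\frac18$ times the defect of $[\cdot,L_f]$ as a derivation of
$[L_c,[L_a,L_b]]$. -/
theorem covDeriv_curvVec (f c a b : Fin m) :
    wirt e (curvVec G c a b) f w + ∑ k, (curvVec G c a b w k • G k f w
      - G c f w k • curvVec G k a b w - G a f w k • curvVec G c k b w
      - G b f w k • curvVec G c a k w) = 0 := by
  apply h.injective w hw
  let B' : PCn m →ₗ[PC] PCn m →ₗ[PC] PCn m := (1 / 4 : ℝ) • B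
  have hev : (fun u => frameMap L u (curvVec G c a b u)) =ᶠ[nhds w]
      fun u => B' (L c u) (B (L a u) (L b u)) := by
    filter_upwards [h.isOpen.mem_nhds hw] with u hu
    exact h.frameMap_curvVec hu hG c a b
  have h1 := wirt_congr (σ := e) (a := f) hev
  have da := h.differentiableAt hw
  rw [h.wirt_frameMap hw ((h.contDiffAt_curvVec hw hG c a b).differentiableAt ne_infty),
    wirt_bilin _ (da c) (differentiableAt_bilin _ (da a) (da b)), wirt_bilin _ (da a) (da b)] at h1
  have h2 : ∑ k, curvVec G c a b w k • frameMap L w (G k f w) =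
      ∑ k, curvVec G c a b w k • wirt e (L k) f w +
        (1 / 2 : ℝ) • B (frameMap L w (curvVec G c a b w)) (L f w) := by
    rw [frameMap_apply, map_sum, LinearMap.sum_apply, Finset.smul_sum, ← Finset.sum_add_distrib]
    refine Finset.sum_congr rfl fun k _ => ?_
    rw [hG.frameMap_eq w hw k f, smul_add, map_smul, LinearMap.smul_apply, smul_comm]
  have hR : ∀ r : ℝ, ∀ u v, B (r • u) v = r • B u v := fun r u v => by
    rw [LinearMap.map_smul_of_tower]; rfl
  have hc : ∑ k, G c f w k • frameMap L w (curvVec G k a b w) =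
      B' (frameMap L w (G c f w)) (B (L a w) (L b w)) := by
    rw [frameMap_apply, map_sum, LinearMap.sum_apply]
    refine Finset.sum_congr rfl fun k _ => ?_
    rw [h.frameMap_curvVec hw hG, map_smul]; rfl
  have ha : ∑ k, G a f w k • frameMap L w (curvVec G c k b w) =
      B' (L c w) (B (frameMap L w (G a f w)) (L b w)) := by
    rw [frameMap_apply L w (G a f w), map_sum, LinearMap.sum_apply, map_sum]
    refine Finset.sum_congr rfl fun k _ => ?_
    have : B (G a f w k • L k w) (L b w) = G a f w k • B (L k w) (L b w) := by rw [map_smul]; rfl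
    rw [h.frameMap_curvVec hw hG, this, map_smul]; rfl
  have hb : ∑ k, G b f w k • frameMap L w (curvVec G c a k w) =
      B' (L c w) (B (L a w) (frameMap L w (G b f w))) := by
    rw [frameMap_apply L w (G b f w), map_sum, map_sum]
    refine Finset.sum_congr rfl fun k _ => ?_
    rw [h.frameMap_curvVec hw hG, map_smul, map_smul]; rfl
  rw [h.wirt_eq hw hG c f, h.wirt_eq hw hG a f, h.wirt_eq hw hG b f] at h1
  simp only [map_add, map_sub, map_sum, map_smul, Finset.sum_sub_distrib, map_zero]
  rw [h2, hc, ha, hb, h.frameMap_curvVec hw hG]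
  -- The derivation rule for the double bracket takes two Jacobi identities: one for the outer
  -- bracket, and one for the inner bracket placed inside $[L_c,\cdot]$.
  have j1 := h.jacobi hw (L c w) (B (L a w) (L b w)) (L f w)
  have j2 := congrArg (B (L c w)) (h.jacobi hw (L a w) (L b w) (L f w))
  rw [h.antisymm (B (B (L a w) (L b w)) (L f w)) (L c w),
    h.antisymm (L f w) (L c w), map_neg, LinearMap.neg_apply] at j1
  rw [map_add, map_add, h.antisymm (B (L b w) (L f w)) (L a w),
    h.antisymm (L f w) (L a w)] at j2
  simp only [B', map_add, map_sub, map_neg, LinearMap.neg_apply,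
    LinearMap.smul_apply, LinearMap.sub_apply, map_zero, LinearMap.map_smul_of_tower] at h1 j1 j2 ⊢
  linear_combination (norm := module) h1 + (1 / 8 : ℝ) • j1 + (1 / 8 : ℝ) • j2

/-- The columns $L_k$ are killed by $\partial/\partial\bar z^f$, hence so are their brackets. The
Leibniz rule leaves only the image of the derivative of the curvature, and the frame is injective.
-/
theorem wirt_bar_curvVec (f c a b : Fin m) : wirt (-e) (curvVec G c a b) f w = 0 := by
  apply h.injective w hw
  let B' : PCn m →ₗ[PC] PCn m →ₗ[PC] PCn m := (1 / 4 : ℝ) • B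
  have hev : (fun u => frameMap L u (curvVec G c a b u)) =ᶠ[nhds w]
      fun u => B' (L c u) (B (L a u) (L b u)) := by
    filter_upwards [h.isOpen.mem_nhds hw] with u hu
    exact h.frameMap_curvVec hu hG c a b
  have h1 := wirt_congr (σ := -e) (a := f) hev
  have da := h.differentiableAt hw
  rw [h.wirt_frameMap hw ((h.contDiffAt_curvVec hw hG c a b).differentiableAt ne_infty),
    wirt_bilin _ (da c) (differentiableAt_bilin _ (da a) (da b)), wirt_bilin _ (da a) (da b)] at h1
  simpa [h.bar w hw] using h1

end IsCoframe

end Frames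

/-! ### Para-holomorphic maps from flat spaces to the group -/

section Group

variable {m : ℕ}
  {V : Type*} [NormedAddCommGroup V] [NormedSpace ℝ V] [Module PC V] [IsScalarTower ℝ PC V]
  {V' : Type*} [NormedAddCommGroup V'] [NormedSpace ℝ V'] [Module PC V'] [IsScalarTower ℝ PC V']
  {V'' : Type*} [NormedAddCommGroup V''] [NormedSpace ℝ V''] [Module PC V''] [IsScalarTower ℝ PC V'']
  {E : Type*} [NormedAddCommGroup E] [NormedSpace ℝ E]
  {G : Type*} [TopologicalSpace G] [ChartedSpace E G]

theorem fderiv_fderiv_comp_apply {X Y W : Type*} [NormedAddCommGroup X] [NormedSpace ℝ X]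
    [NormedAddCommGroup Y] [NormedSpace ℝ Y] [NormedAddCommGroup W] [NormedSpace ℝ W]
    {F : X → Y} {g : W → X} {g' : W →L[ℝ] X} {w : W} (hg : HasFDerivAt g g' w)
    (hF : ContDiffAt ℝ ∞ F (g w)) (v : X) (u : W) :
    fderiv ℝ (fun y => fderiv ℝ F (g y) v) w u = fderiv ℝ (fderiv ℝ F) (g w) (g' u) v := by
  have h := (contDiffAt_fderiv_apply hF v).differentiableAt ne_infty
  have := (h.hasFDerivAt.comp w hg).fderiv
  rw [← fderiv_fderiv_apply hF]
  exact congrArg (fun A : W →L[ℝ] Y => A u) this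

theorem pholAt_id (v : V) : PHolAt (fun u : V => u) v :=
  ⟨contDiffAt_id, fun u => by simp⟩

theorem pholAt_const (v : V) (v' : V') : PHolAt (fun _ : V => v') v :=
  ⟨contDiffAt_const, fun u => by simp⟩

theorem pholAt_fst (z : V × V') : PHolAt (fun u : V × V' => u.1) z :=
  ⟨contDiffAt_fst, fun u => by simp [fderiv_fst]⟩

theorem pholAt_snd (z : V × V') : PHolAt (fun u : V × V' => u.2) z :=
  ⟨contDiffAt_snd, fun u => by simp [fderiv_snd]⟩

theorem PHolAt.differentiableAt {F : V → V'} {v : V} (h : PHolAt F v) : DifferentiableAt ℝ F v :=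
  h.smooth.differentiableAt ne_infty

theorem PHolAt.prodMk {F : V → V'} {F' : V → V''} {v : V} (h : PHolAt F v) (h' : PHolAt F' v) :
    PHolAt (fun u => (F u, F' u)) v := by
  refine ⟨h.smooth.prodMk h'.smooth, fun u => ?_⟩
  rw [h.differentiableAt.fderiv_prodMk h'.differentiableAt]
  simp [h.comm, h'.comm]

theorem dz_component {n : ℕ} {F : PCn m → PCn n} {w : PCn m} (h : PHolAt F w) (a : Fin n)
    (b : Fin m) : dz (fun u => F u a) b w = fderiv ℝ F w (Pi.single b 1) a := by
  rw [dz_eq_wirt, ← wirt_apply h.differentiableAt, h.wirt_e]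

/-- `F` is smooth near `v`, and its derivative at `v` intertwines multiplication by `e` and `J`. -/
structure GHolAt (J : EndField 𝓘(ℝ, E) G) (F : V → G) (v : V) : Prop where
  smooth : ContMDiffAt 𝓘(ℝ, V) 𝓘(ℝ, E) ∞ F v
  comm : ∀ u : V, mfderiv 𝓘(ℝ, V) 𝓘(ℝ, E) F v (e • u : V) =
    J (F v) (mfderiv 𝓘(ℝ, V) 𝓘(ℝ, E) F v u)

theorem GHolAt.comp {J : EndField 𝓘(ℝ, E) G} {F : V' → G} {f : V → V'} {v : V}
    (hF : GHolAt J F (f v)) (hf : PHolAt f v) : GHolAt J (fun u => F (f u)) v := by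
  have hfs : ContMDiffAt 𝓘(ℝ, V) 𝓘(ℝ, V') ∞ f v := contMDiffAt_iff_contDiffAt.2 hf.smooth
  refine ⟨hF.smooth.comp v hfs, fun u => ?_⟩
  have := mfderiv_comp v (hF.smooth.mdifferentiableAt ne_infty) (hfs.mdifferentiableAt ne_infty)
  have h2 : mfderiv 𝓘(ℝ, V) 𝓘(ℝ, E) (fun u => F (f u)) v = _ := this
  rw [h2, mfderiv_eq_fderiv]
  change mfderiv 𝓘(ℝ, V') 𝓘(ℝ, E) F (f v) (fderiv ℝ f v (e • u)) =
    J (F (f v)) (mfderiv 𝓘(ℝ, V') 𝓘(ℝ, E) F (f v) (fderiv ℝ f v u))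
  rw [hf.comm, hF.comm]

theorem GHolAt.chart {J : EndField 𝓘(ℝ, E) G} {x : OpenPartialHomeomorph G (PCn m)}
    (hx : IsParaHolChart J x) {F : V → G} {v : V} (hF : GHolAt J F v) (hv : F v ∈ x.source) :
    PHolAt (fun u => x (F u)) v := by
  have hxs : ContMDiffAt 𝓘(ℝ, E) 𝓘(ℝ, PCn m) ∞ x (F v) :=
    hx.toFun.smooth.contMDiffAt (x.open_source.mem_nhds hv)
  refine ⟨contMDiffAt_iff_contDiffAt.1 (hxs.comp v hF.smooth), fun u => ?_⟩
  have := mfderiv_comp v (hxs.mdifferentiableAt ne_infty) (hF.smooth.mdifferentiableAt ne_infty)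
  rw [mfderiv_eq_fderiv] at this
  have h2 : fderiv ℝ (fun u => x (F u)) v = _ := this
  rw [h2]
  change mfderiv 𝓘(ℝ, E) 𝓘(ℝ, PCn m) x (F v) (mfderiv 𝓘(ℝ, V) 𝓘(ℝ, E) F v (e • u : V)) =
    @HSMul.hSMul PC (PCn m) (PCn m) _ e
      (mfderiv 𝓘(ℝ, E) 𝓘(ℝ, PCn m) x (F v) (mfderiv 𝓘(ℝ, V) 𝓘(ℝ, E) F v u))
  rw [hF.comm]
  exact hx.toFun.commutes (F v) hv _

theorem IsParaHolChart.gholAt_symm {J : EndField 𝓘(ℝ, E) G} {x : OpenPartialHomeomorph G (PCn m)}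
    (hx : IsParaHolChart J x) {w : PCn m} (hw : w ∈ x.target) : GHolAt J x.symm w :=
  ⟨hx.invFun.smooth.contMDiffAt (x.open_target.mem_nhds hw), hx.invFun.commutes w hw⟩

theorem GHolAt.eventually_chart {J : EndField 𝓘(ℝ, E) G} {x : OpenPartialHomeomorph G (PCn m)}
    (hx : IsParaHolChart J x) {F : V → G} {v : V} (hF : ∀ᶠ u in nhds v, GHolAt J F u)
    (hv : F v ∈ x.source) : ∀ᶠ u in nhds v, F u ∈ x.source ∧ PHolAt (fun u => x (F u)) u := by
  filter_upwards [hF, hF.self_of_nhds.smooth.continuousAt (x.open_source.mem_nhds hv)] with u h1 h2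
  exact ⟨h2, h1.chart hx h2⟩

variable [IsManifold 𝓘(ℝ, E) ∞ G] [Group G]

theorem GHolAt.mul {J : EndField 𝓘(ℝ, E) G} (hG : IsParaComplexLieGroup J) {F F' : V → G} {v : V}
    (hF : GHolAt J F v) (hF' : GHolAt J F' v) : GHolAt J (fun u => F u * F' u) v := by
  have hm : ContMDiffAt (𝓘(ℝ, E).prod 𝓘(ℝ, E)) 𝓘(ℝ, E) ∞ (fun p : G × G => p.1 * p.2)
      (F v, F' v) := hG.mul.smooth.contMDiffAt Filter.univ_mem
  have hp := hF.smooth.prodMk hF'.smooth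
  refine ⟨hm.comp v hp, fun u => ?_⟩
  have := mfderiv_comp v (hm.mdifferentiableAt ne_infty) (hp.mdifferentiableAt ne_infty)
  have h2 : mfderiv 𝓘(ℝ, V) 𝓘(ℝ, E) (fun u => F u * F' u) v = _ := this
  rw [h2, mfderiv_prodMk (hF.smooth.mdifferentiableAt ne_infty)
    (hF'.smooth.mdifferentiableAt ne_infty)]
  have h3 := hG.mul.commutes (F v, F' v) trivial
    (mfderiv 𝓘(ℝ, V) 𝓘(ℝ, E) F v u, mfderiv 𝓘(ℝ, V) 𝓘(ℝ, E) F' v u)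
  refine Eq.trans ?_ h3
  exact congrArg (mfderiv (𝓘(ℝ, E).prod 𝓘(ℝ, E)) 𝓘(ℝ, E) (fun p : G × G => p.1 * p.2) (F v, F' v))
    (Prod.ext (hF.comm u) (hF'.comm u))

theorem GHolAt.inv {J : EndField 𝓘(ℝ, E) G} (hG : IsParaComplexLieGroup J) {F : V → G} {v : V}
    (hF : GHolAt J F v) : GHolAt J (fun u => (F u)⁻¹) v := by
  have hm : ContMDiffAt 𝓘(ℝ, E) 𝓘(ℝ, E) ∞ (fun p : G => p⁻¹) (F v) :=
    hG.inv.smooth.contMDiffAt Filter.univ_mem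
  refine ⟨hm.comp v hF.smooth, fun u => ?_⟩
  have := mfderiv_comp v (hm.mdifferentiableAt ne_infty) (hF.smooth.mdifferentiableAt ne_infty)
  have h2 : mfderiv 𝓘(ℝ, V) 𝓘(ℝ, E) (fun u => (F u)⁻¹) v = _ := this
  rw [h2]
  refine Eq.trans ?_ (hG.inv.commutes (F v) trivial _)
  exact congrArg (mfderiv 𝓘(ℝ, E) 𝓘(ℝ, E) (fun p : G => p⁻¹) (F v)) (hF.comm u)

/-! ### The coordinate expressions of the group operations -/

/-- The coordinates of the right quotient `p q⁻¹`. -/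
def quot (x ψ : OpenPartialHomeomorph G (PCn m)) (z : PCn m × PCn m) : PCn m :=
  x (ψ.symm z.1 * (ψ.symm z.2)⁻¹)

/-- The coordinates of the product, as a function of two arguments. -/
def prodLaw (x ψ χ : OpenPartialHomeomorph G (PCn m)) (z : PCn m × PCn m) : PCn m :=
  χ (x.symm z.1 * ψ.symm z.2)

variable {J : EndField 𝓘(ℝ, E) G} {x ψ χ : OpenPartialHomeomorph G (PCn m)}

theorem eventually_quot (hG : IsParaComplexLieGroup J) (hx : IsParaHolChart J x)
    (hψ : IsParaHolChart J ψ) {z : PCn m × PCn m} (h1 : z.1 ∈ ψ.target) (h2 : z.2 ∈ ψ.target)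
    (h : ψ.symm z.1 * (ψ.symm z.2)⁻¹ ∈ x.source) :
    ∀ᶠ y in nhds z, ψ.symm y.1 * (ψ.symm y.2)⁻¹ ∈ x.source ∧ PHolAt (quot x ψ) y := by
  refine GHolAt.eventually_chart hx (F := fun y : PCn m × PCn m => ψ.symm y.1 * (ψ.symm y.2)⁻¹) ?_ h
  filter_upwards [(ψ.open_target.prod ψ.open_target).mem_nhds ⟨h1, h2⟩] with y hy
  exact ((hψ.gholAt_symm hy.1).comp (pholAt_fst y)).mul hG
    (((hψ.gholAt_symm hy.2).comp (pholAt_snd y)).inv hG)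

theorem eventually_prodLaw (hG : IsParaComplexLieGroup J) (hx : IsParaHolChart J x)
    (hψ : IsParaHolChart J ψ) (hχ : IsParaHolChart J χ) {z : PCn m × PCn m} (h1 : z.1 ∈ x.target)
    (h2 : z.2 ∈ ψ.target) (h : x.symm z.1 * ψ.symm z.2 ∈ χ.source) :
    ∀ᶠ y in nhds z, x.symm y.1 * ψ.symm y.2 ∈ χ.source ∧ PHolAt (prodLaw x ψ χ) y := by
  refine GHolAt.eventually_chart hχ (F := fun y : PCn m × PCn m => x.symm y.1 * ψ.symm y.2) ?_ h
  filter_upwards [(x.open_target.prod ψ.open_target).mem_nhds ⟨h1, h2⟩] with y hy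
  exact ((hx.gholAt_symm hy.1).comp (pholAt_fst y)).mul hG
    ((hψ.gholAt_symm hy.2).comp (pholAt_snd y))

/-- The columns of the matrix `λ`. -/
def lamCol (x ψ : OpenPartialHomeomorph G (PCn m)) (b : Fin m) (w : PCn m) : PCn m :=
  fun a => lam x ψ w a b

/-- The bracket with the structure constants `C^a_{bc}`. -/
def bracket (x : OpenPartialHomeomorph G (PCn m)) : PCn m →ₗ[PC] PCn m →ₗ[PC] PCn m :=
  LinearMap.mk₂ PC (fun u v d => ∑ p, ∑ q, structConst x d p q * u p * v q)
    (fun u u' v => by ext1 d; simp [mul_add, add_mul, Finset.sum_add_distrib])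
    (fun c u v => by
      ext1 d
      simp only [Pi.smul_apply, smul_eq_mul, Finset.mul_sum]
      exact Finset.sum_congr rfl fun p _ => Finset.sum_congr rfl fun q _ => by ring)
    (fun u v v' => by ext1 d; simp [mul_add, Finset.sum_add_distrib])
    (fun c u v => by
      ext1 d
      simp only [Pi.smul_apply, smul_eq_mul, Finset.mul_sum]
      exact Finset.sum_congr rfl fun p _ => Finset.sum_congr rfl fun q _ => by ring)

theorem bracket_apply (x : OpenPartialHomeomorph G (PCn m)) (u v : PCn m) (d : Fin m) :
    bracket x u v d = ∑ p, ∑ q, structConst x d p q * u p * v q := rfl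

theorem hasFDerivAt_left (w w' : PCn m) :
    HasFDerivAt (fun u : PCn m => (u, w')) (ContinuousLinearMap.inl ℝ (PCn m) (PCn m)) w :=
  hasFDerivAt_prodMk_left w w'

theorem hasFDerivAt_right (w w' : PCn m) :
    HasFDerivAt (fun u : PCn m => (w, u)) (ContinuousLinearMap.inr ℝ (PCn m) (PCn m)) w' :=
  hasFDerivAt_prodMk_right w w'

theorem fderiv_left {F : PCn m × PCn m → V} {w w' : PCn m} (h : DifferentiableAt ℝ F (w, w'))
    (u : PCn m) : fderiv ℝ (fun y => F (y, w')) w u = fderiv ℝ F (w, w') (u, 0) := by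
  have := (h.hasFDerivAt.comp w (hasFDerivAt_left w w')).fderiv
  exact congrArg (fun A : PCn m →L[ℝ] V => A u) this

theorem fderiv_right {F : PCn m × PCn m → V} {w w' : PCn m} (h : DifferentiableAt ℝ F (w, w'))
    (u : PCn m) : fderiv ℝ (fun y => F (w, y)) w' u = fderiv ℝ F (w, w') (0, u) := by
  have := (h.hasFDerivAt.comp w' (hasFDerivAt_right w w')).fderiv
  exact congrArg (fun A : PCn m →L[ℝ] V => A u) this

theorem PHolAt.left {F : PCn m × PCn m → V} {w w' : PCn m} (h : PHolAt F (w, w')) :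
    PHolAt (fun y => F (y, w')) w :=
  PHolAt.comp (F := fun y => (y, w')) h ((pholAt_id w).prodMk (pholAt_const w w'))

theorem PHolAt.right {F : PCn m × PCn m → V} {w w' : PCn m} (h : PHolAt F (w, w')) :
    PHolAt (fun y => F (w, y)) w' :=
  PHolAt.comp (F := fun y => (w, y)) h ((pholAt_const w' w).prodMk (pholAt_id w'))

/-- The second mixed derivative of the product at the identity. -/
def mixed (x : OpenPartialHomeomorph G (PCn m)) (u v : PCn m) : PCn m :=
  fderiv ℝ (fderiv ℝ (prodLaw x x x)) (0, 0) (0, v) (u, 0)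

/-! ### Maurer–Cartan equations and invertibility of the right-invariant coframe -/

section AtIdentity

variable (hG : IsParaComplexLieGroup J) (hx : IsParaHolChart J x) (hx1 : 1 ∈ x.source)
  (hx0 : x 1 = 0)
include hx1 hx0

theorem zero_mem_target : (0 : PCn m) ∈ x.target := hx0 ▸ x.map_source hx1

theorem symm_zero : x.symm 0 = 1 := by rw [← hx0, x.left_inv hx1]

include hG hx

theorem eventually_prodLaw_zero : ∀ᶠ y in nhds ((0, 0) : PCn m × PCn m),
    x.symm y.1 * x.symm y.2 ∈ x.source ∧ PHolAt (prodLaw x x x) y :=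
  eventually_prodLaw hG hx hx hx (zero_mem_target hx1 hx0) (zero_mem_target hx1 hx0)
    (by simpa [symm_zero hx1 hx0] using hx1)

/-- Replaces iterated Wirtinger derivatives by one real second derivative. The product is
para-holomorphic in a whole neighbourhood of the origin, so its second derivative is para-complex
bilinear; this makes the inner derivative para-holomorphic at the origin as a function of $z$. -/
theorem secondOrder_eq (a b c : Fin m) :
    secondOrder x a b c = mixed x (Pi.single b 1) (Pi.single c 1) a := by
  have hev := (eventually_prodLaw_zero hG hx hx1 hx0).mono fun _ h => h.2
  have h0 := hev.self_of_nhds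
  have hz : ∀ᶠ z in nhds (0 : PCn m), PHolAt (prodLaw x x x) (z, 0) :=
    (Continuous.tendsto (by fun_prop : Continuous fun z : PCn m => (z, (0 : PCn m))) 0).eventually hev
  have h1 : (fun z => dz (fun v => groupLaw x z v a) c 0) =ᶠ[nhds 0]
      fun z => fderiv ℝ (prodLaw x x x) (z, 0) (0, Pi.single c 1) a := by
    filter_upwards [hz] with z hz
    rw [← fderiv_right hz.differentiableAt, ← dz_component hz.right]
    rfl
  have hd := fderiv_fderiv_comp_apply (hasFDerivAt_left (0 : PCn m) 0) h0.smooth (0, Pi.single c 1)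
  have hP : PHolAt (fun z => fderiv ℝ (prodLaw x x x) (z, 0) (0, Pi.single c 1)) 0 := by
    refine ⟨ContDiffAt.comp (f := fun z : PCn m => (z, (0 : PCn m))) 0 (contDiffAt_fderiv_apply h0.smooth _)
      (contDiffAt_id.prodMk contDiffAt_const), fun u => ?_⟩
    rw [hd, hd, ContinuousLinearMap.inl_apply, ContinuousLinearMap.inl_apply,
      ← fderiv_fderiv_smul_left hev, Prod.smul_mk, smul_zero]
  rw [secondOrder, dz_eq_wirt, wirt_congr h1, ← dz_eq_wirt, dz_component hP, hd, mixed,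
    fderiv_fderiv_symm h0.smooth]
  rfl

theorem mixed_eq_sum (u v : PCn m) :
    mixed x u v = ∑ p, ∑ q, (u p * v q) • mixed x (Pi.single p 1) (Pi.single q 1) := by
  have hev := (eventually_prodLaw_zero hG hx hx1 hx0).mono fun _ h => h.2
  have h1 : ∀ u v, mixed x u v = ∑ p, u p • mixed x (Pi.single p 1) v := fun u v =>
    sum_smul_apply_single (A := (fderiv ℝ (fderiv ℝ (prodLaw x x x)) (0, 0) (0, v)).comp
      (ContinuousLinearMap.inl ℝ (PCn m) (PCn m))) (fun u => by
        simp only [ContinuousLinearMap.comp_apply, ContinuousLinearMap.inl_apply]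
        rw [← fderiv_fderiv_smul_right hev, Prod.smul_mk, smul_zero]) u
  have h2 : ∀ u v, mixed x u v = ∑ q, v q • mixed x u (Pi.single q 1) := fun u v =>
    sum_smul_apply_single (A := ((fderiv ℝ (fderiv ℝ (prodLaw x x x)) (0, 0)).flip (u, 0)).comp
      (ContinuousLinearMap.inr ℝ (PCn m) (PCn m))) (fun v => by
        simp only [ContinuousLinearMap.comp_apply, ContinuousLinearMap.inr_apply,
          ContinuousLinearMap.flip_apply]
        rw [← fderiv_fderiv_smul_left hev, Prod.smul_mk, smul_zero]) v
  rw [h1]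
  refine Finset.sum_congr rfl fun p _ => ?_
  rw [h2, Finset.smul_sum]
  exact Finset.sum_congr rfl fun q _ => by rw [smul_smul]

/-- This coordinate-free form is the one that the chain rule produces in the structure equations. It
also makes antisymmetry evident. -/
theorem bracket_eq_mixed (u v : PCn m) : bracket x u v = mixed x u v - mixed x v u := by
  ext1 d
  rw [bracket_apply, Pi.sub_apply, mixed_eq_sum hG hx hx1 hx0 u v, mixed_eq_sum hG hx hx1 hx0 v u,
    Finset.sum_comm (γ := Fin m) (f := fun p q => (v p * u q) • mixed x (Pi.single p 1) (Pi.single q 1))]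
  simp only [Finset.sum_apply, ← Finset.sum_sub_distrib, structConst,
    secondOrder_eq hG hx hx1 hx0, Pi.smul_apply, smul_eq_mul]
  exact Finset.sum_congr rfl fun p _ => Finset.sum_congr rfl fun q _ => by ring

variable (hψ : IsParaHolChart J ψ) {w : PCn m} (hw : w ∈ ψ.target)
include hψ hw

theorem eventually_quot_diag : ∀ᶠ y in nhds (w, w),
    ψ.symm y.1 * (ψ.symm y.2)⁻¹ ∈ x.source ∧ PHolAt (quot x ψ) y :=
  eventually_quot hG hx hψ hw hw (by simpa using hx1)

theorem quot_diag : quot x ψ (w, w) = 0 := by simp [quot, hx0]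

theorem pholAt_quot : PHolAt (quot x ψ) (w, w) :=
  (eventually_quot_diag hG hx hx1 hx0 hψ hw).self_of_nhds.2

theorem lamCol_eq (b : Fin m) :
    lamCol x ψ b w = fderiv ℝ (quot x ψ) (w, w) (Pi.single b 1, 0) := by
  have h := pholAt_quot hG hx hx1 hx0 hψ hw
  ext1 a
  rw [← fderiv_left h.differentiableAt, ← dz_component h.left]
  rfl

theorem frameMap_lamCol (u : PCn m) :
    frameMap (lamCol x ψ) w u = fderiv ℝ (fun y => quot x ψ (y, w)) w u := by
  have h := pholAt_quot hG hx hx1 hx0 hψ hw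
  rw [sum_smul_apply_single h.left.comm u, frameMap_apply]
  refine Finset.sum_congr rfl fun b _ => ?_
  rw [lamCol_eq hG hx hx1 hx0 hψ hw, fderiv_left h.differentiableAt]

theorem lamCol_eventuallyEq (b : Fin m) :
    lamCol x ψ b =ᶠ[nhds w] fun y => fderiv ℝ (quot x ψ) (y, y) (Pi.single b 1, 0) := by
  filter_upwards [ψ.open_target.mem_nhds hw] with y hy
  exact lamCol_eq hG hx hx1 hx0 hψ hy b

/-- In $\lambda(w)$ the base point enters both arguments of the quotient, so moving $w$
differentiates along the diagonal direction $(u,u)$. -/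
theorem fderiv_lamCol (b : Fin m) (u : PCn m) :
    fderiv ℝ (lamCol x ψ b) w u =
      fderiv ℝ (fderiv ℝ (quot x ψ)) (w, w) (u, u) (Pi.single b 1, 0) := by
  have hdiag : HasFDerivAt (fun y : PCn m => (y, y))
      ((ContinuousLinearMap.id ℝ (PCn m)).prod (ContinuousLinearMap.id ℝ (PCn m))) w :=
    (hasFDerivAt_id w).prodMk (hasFDerivAt_id w)
  rw [(lamCol_eventuallyEq hG hx hx1 hx0 hψ hw b).fderiv_eq,
    fderiv_fderiv_comp_apply hdiag (pholAt_quot hG hx hx1 hx0 hψ hw).smooth]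
  rfl

theorem pholAt_lamCol (b : Fin m) : PHolAt (lamCol x ψ b) w := by
  have h := pholAt_quot hG hx hx1 hx0 hψ hw
  have hev := (eventually_quot_diag hG hx hx1 hx0 hψ hw).mono fun _ h => h.2
  refine ⟨ContDiffAt.congr_of_eventuallyEq ?_ (lamCol_eventuallyEq hG hx hx1 hx0 hψ hw b), fun u => ?_⟩
  · exact ContDiffAt.comp (f := fun y : PCn m => (y, y)) w (contDiffAt_fderiv_apply h.smooth _) (contDiffAt_id.prodMk contDiffAt_id)
  · rw [fderiv_lamCol hG hx hx1 hx0 hψ hw, fderiv_lamCol hG hx hx1 hx0 hψ hw,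
      ← fderiv_fderiv_smul_left hev, Prod.smul_mk]

/-- The quotient map factors near the diagonal through the product near the identity. -/
theorem quot_eventuallyEq : quot x ψ =ᶠ[nhds (w, w)]
    fun z => prodLaw x x x (quot x ψ (z.1, w), quot x ψ (w, z.2)) := by
  have hev := eventually_quot_diag hG hx hx1 hx0 hψ hw
  have e1 := (Continuous.tendsto (by fun_prop : Continuous fun z : PCn m × PCn m => (z.1, w))
    (w, w)).eventually hev
  have e2 := (Continuous.tendsto (by fun_prop : Continuous fun z : PCn m × PCn m => (w, z.2))
    (w, w)).eventually hev
  filter_upwards [e1, e2] with z h1 h2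
  simp only [prodLaw, quot, x.left_inv h1.1, x.left_inv h2.1]
  congr 1
  group

/-- The quotient is constant on the diagonal, so its derivative kills $(u,u)$. -/
theorem fderiv_quot_diag (u : PCn m) :
    fderiv ℝ (quot x ψ) (w, w) (0, u) = -fderiv ℝ (quot x ψ) (w, w) (u, 0) := by
  have h := pholAt_quot hG hx hx1 hx0 hψ hw
  have hdiag : HasFDerivAt (fun y : PCn m => (y, y))
      ((ContinuousLinearMap.id ℝ (PCn m)).prod (ContinuousLinearMap.id ℝ (PCn m))) w :=
    (hasFDerivAt_id w).prodMk (hasFDerivAt_id w)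
  have h0 : (quot x ψ ∘ fun y : PCn m => (y, y)) = fun _ => x 1 := by
    funext y; simp [quot]
  have h1 := (HasFDerivAt.comp (f := fun y : PCn m => (y, y)) w h.differentiableAt.hasFDerivAt hdiag).fderiv
  rw [h0] at h1
  have h2 := congrArg (fun A : PCn m →L[ℝ] PCn m => A u) h1
  simp only [fderiv_fun_const, Pi.zero_apply] at h2
  have h3 : fderiv ℝ (quot x ψ) (w, w) (u, u) = 0 := h2.symm
  have h4 : ((u, u) : PCn m × PCn m) = (0, u) + (u, 0) := by simp
  rw [h4, map_add] at h3
  exact eq_neg_of_add_eq_zero_left h3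

/-- In the factorisation `quot_eventuallyEq` the two variables sit in separate arguments of the
product, so the mixed derivative is that of the product at the identity, applied to the two partial
derivatives of the quotient. The one in the second variable brings the minus sign. -/
theorem fderiv_fderiv_quot_mixed (u v : PCn m) :
    fderiv ℝ (fderiv ℝ (quot x ψ)) (w, w) (0, v) (u, 0) =
      -mixed x (fderiv ℝ (quot x ψ) (w, w) (u, 0)) (fderiv ℝ (quot x ψ) (w, w) (v, 0)) := by
  have hq := pholAt_quot hG hx hx1 hx0 hψ hw
  have hev := eventually_prodLaw_zero hG hx hx1 hx0
  have hq0 : quot x ψ (w, w) = 0 := quot_diag hG hx hx1 hx0 hψ hw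
  have hcont : ContinuousAt (fun y => ((0 : PCn m), quot x ψ (w, y))) w :=
    continuousAt_const.prodMk hq.right.differentiableAt.continuousAt
  have hprod : ∀ᶠ y in nhds w, PHolAt (prodLaw x x x) ((0 : PCn m), quot x ψ (w, y)) := by
    refine hcont.eventually (p := fun z => PHolAt (prodLaw x x x) z) ?_
    change ∀ᶠ z in nhds ((0 : PCn m), quot x ψ (w, w)), PHolAt (prodLaw x x x) z
    rw [hq0]
    exact hev.mono fun _ h => h.2
  have hquot : ∀ᶠ y in nhds w, PHolAt (quot x ψ) (w, y) :=
    (Continuous.tendsto (by fun_prop : Continuous fun y : PCn m => (w, y)) w).eventually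
      ((eventually_quot_diag hG hx hx1 hx0 hψ hw).mono fun _ h => h.2)
  have heq : ∀ᶠ y in nhds w, quot x ψ =ᶠ[nhds (w, y)]
      fun z => prodLaw x x x (quot x ψ (z.1, w), quot x ψ (w, z.2)) :=
    (Continuous.tendsto (by fun_prop : Continuous fun y : PCn m => (w, y)) w).eventually
      (quot_eventuallyEq hG hx hx1 hx0 hψ hw).eventually_nhds
  -- The first derivative is needed for all $y$ near $w$, not only at $w$, since it is
  -- differentiated in $y$ next.
  have h1 : (fun y => fderiv ℝ (quot x ψ) (w, y) (u, 0)) =ᶠ[nhds w]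
      fun y => fderiv ℝ (prodLaw x x x) (0, quot x ψ (w, y))
        (fderiv ℝ (quot x ψ) (w, w) (u, 0), 0) := by
    filter_upwards [hprod, hquot, heq] with y hy1 hy2 hy3
    rw [← fderiv_left hy2.differentiableAt, ← fderiv_left hy1.differentiableAt,
      ← fderiv_left hq.differentiableAt]
    have h2 : (fun y' => quot x ψ (y', y)) =ᶠ[nhds w]
        fun y' => prodLaw x x x (quot x ψ (y', w), quot x ψ (w, y)) :=
      (Continuous.tendsto (by fun_prop : Continuous fun y' : PCn m => (y', y)) w).eventually hy3
    rw [h2.fderiv_eq]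
    have h3 : DifferentiableAt ℝ (fun y' => prodLaw x x x (y', quot x ψ (w, y))) (quot x ψ (w, w)) := by
      rw [hq0]; exact hy1.left.differentiableAt
    have h4 := fderiv_fun_comp (g := fun y' => prodLaw x x x (y', quot x ψ (w, y)))
      (f := fun y' => quot x ψ (y', w)) w h3 hq.left.differentiableAt
    rw [h4, hq0]
    rfl
  have h5 := fderiv_fderiv_comp_apply (hasFDerivAt_right w w) hq.smooth (u, 0) v
  rw [ContinuousLinearMap.inr_apply] at h5
  rw [← h5, h1.fderiv_eq]
  have h6 : HasFDerivAt (fun y => ((0 : PCn m), quot x ψ (w, y)))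
      ((0 : PCn m →L[ℝ] PCn m).prod (fderiv ℝ (fun y => quot x ψ (w, y)) w)) w :=
    (hasFDerivAt_const _ _).prodMk hq.right.differentiableAt.hasFDerivAt
  have h7 : ContDiffAt ℝ ∞ (prodLaw x x x) ((0 : PCn m), quot x ψ (w, w)) := by
    rw [hq0]; exact hev.self_of_nhds.2.smooth
  rw [fderiv_fderiv_comp_apply h6 h7, hq0, ContinuousLinearMap.prod_apply,
    zero_apply, fderiv_right hq.differentiableAt,
    fderiv_quot_diag hG hx hx1 hx0 hψ hw, mixed]
  have h8 : ∀ v : PCn m, ((0, -v) : PCn m × PCn m) = -(0, v) := fun v => by simp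
  rw [h8, map_neg]
  rfl

/-- Split the diagonal direction as $(v,0)+(0,v)$. The part with both derivatives in the first
variable is symmetric in $b,c$ and drops out; the mixed part antisymmetrises to the bracket. -/
theorem maurerCartan_lamCol (b c : Fin m) :
    wirt e (lamCol x ψ b) c w - wirt e (lamCol x ψ c) b w =
      -bracket x (lamCol x ψ b w) (lamCol x ψ c w) := by
  have hs := (pholAt_quot hG hx hx1 hx0 hψ hw).smooth
  have h8 : ∀ v : PCn m, ((v, v) : PCn m × PCn m) = (v, 0) + (0, v) := fun v => by simp
  have key : ∀ b c : Fin m, wirt e (lamCol x ψ b) c w =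
      fderiv ℝ (fderiv ℝ (quot x ψ)) (w, w) (Pi.single c 1, 0) (Pi.single b 1, 0) -
        mixed x (lamCol x ψ b w) (lamCol x ψ c w) := by
    intro b c
    rw [(pholAt_lamCol hG hx hx1 hx0 hψ hw b).wirt_e, fderiv_lamCol hG hx hx1 hx0 hψ hw, h8 (Pi.single c 1),
      map_add, add_apply, fderiv_fderiv_quot_mixed hG hx hx1 hx0 hψ hw,
      ← lamCol_eq hG hx hx1 hx0 hψ hw, ← lamCol_eq hG hx hx1 hx0 hψ hw, sub_eq_add_neg]
  rw [key, key, bracket_eq_mixed hG hx hx1 hx0, fderiv_fderiv_symm hs]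
  abel

theorem prodLaw_zero : prodLaw x ψ ψ (0, w) = w := by
  simp [prodLaw, symm_zero hx1 hx0, ψ.right_inv hw]

theorem eventually_prodLaw_left : ∀ᶠ y in nhds ((0, w) : PCn m × PCn m),
    x.symm y.1 * ψ.symm y.2 ∈ ψ.source ∧ PHolAt (prodLaw x ψ ψ) y :=
  eventually_prodLaw hG hx hψ hψ (zero_mem_target hx1 hx0) hw
    (by simpa [symm_zero hx1 hx0] using ψ.map_target hw)

/-- With $p$ the point at $w$, the maps $q\mapsto qp^{-1}$ and $g\mapsto gp$ are mutually inverse,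
and $\lambda(w)$ is the derivative of the first. The derivative of the second is thus an explicit
inverse of the frame. -/
theorem fderiv_prodLaw_frameMap (u : PCn m) :
    fderiv ℝ (prodLaw x ψ ψ) (0, w) (frameMap (lamCol x ψ) w u, 0) = u := by
  have hp := (eventually_prodLaw_left hG hx hx1 hx0 hψ hw).self_of_nhds.2
  have hq := pholAt_quot hG hx hx1 hx0 hψ hw
  have hq0 : quot x ψ (w, w) = 0 := quot_diag hG hx hx1 hx0 hψ hw
  have hid : (fun y => prodLaw x ψ ψ (quot x ψ (y, w), w)) =ᶠ[nhds w] fun y => y := by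
    filter_upwards [(Continuous.tendsto (by fun_prop : Continuous fun y : PCn m => (y, w)) w).eventually
      (eventually_quot_diag hG hx hx1 hx0 hψ hw), ψ.open_target.mem_nhds hw] with y h1 h2
    simp [prodLaw, quot, x.left_inv h1.1, ψ.right_inv h2]
  have h3 : DifferentiableAt ℝ (fun y => prodLaw x ψ ψ (y, w)) (quot x ψ (w, w)) := by
    rw [hq0]; exact hp.left.differentiableAt
  have h4 := fderiv_fun_comp (g := fun y => prodLaw x ψ ψ (y, w))
    (f := fun y => quot x ψ (y, w)) w h3 hq.left.differentiableAt
  rw [hid.fderiv_eq, hq0] at h4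
  have h5 := congrArg (fun A : PCn m →L[ℝ] PCn m => A u) h4
  rw [← fderiv_left hp.differentiableAt, frameMap_lamCol hG hx hx1 hx0 hψ hw]
  simpa using h5.symm

theorem frameMap_fderiv_prodLaw (u : PCn m) :
    frameMap (lamCol x ψ) w (fderiv ℝ (prodLaw x ψ ψ) (0, w) (u, 0)) = u := by
  have hp := (eventually_prodLaw_left hG hx hx1 hx0 hψ hw).self_of_nhds.2
  have hq := pholAt_quot hG hx hx1 hx0 hψ hw
  have hp0 : prodLaw x ψ ψ (0, w) = w := prodLaw_zero hG hx hx1 hx0 hψ hw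
  have hid : (fun y => quot x ψ (prodLaw x ψ ψ (y, w), w)) =ᶠ[nhds 0] fun y => y := by
    filter_upwards [(Continuous.tendsto (by fun_prop : Continuous fun y : PCn m => (y, w)) 0).eventually
      (eventually_prodLaw_left hG hx hx1 hx0 hψ hw),
      x.open_target.mem_nhds (zero_mem_target hx1 hx0)] with y h1 h2
    simp [prodLaw, quot, ψ.left_inv h1.1, x.right_inv h2]
  have h3 : DifferentiableAt ℝ (fun y => quot x ψ (y, w)) (prodLaw x ψ ψ (0, w)) := by
    rw [hp0]; exact hq.left.differentiableAt
  have h4 := fderiv_fun_comp (g := fun y => quot x ψ (y, w))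
    (f := fun y => prodLaw x ψ ψ (y, w)) 0 h3 hp.left.differentiableAt
  rw [hid.fderiv_eq, hp0] at h4
  have h5 := congrArg (fun A : PCn m →L[ℝ] PCn m => A u) h4
  rw [← fderiv_left hp.differentiableAt, frameMap_lamCol hG hx hx1 hx0 hψ hw]
  simpa using h5.symm

end AtIdentity

theorem isCoframe_lamCol (hG : IsParaComplexLieGroup J) (hx : IsParaHolChart J x)
    (hx1 : 1 ∈ x.source) (hx0 : x 1 = 0) (hψ : IsParaHolChart J ψ) :
    IsCoframe ψ.target (bracket x) (lamCol x ψ) where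
  isOpen := ψ.open_target
  smooth w hw b := (pholAt_lamCol hG hx hx1 hx0 hψ hw b).smooth
  maurerCartan w hw := maurerCartan_lamCol hG hx hx1 hx0 hψ hw
  bar w hw b := (pholAt_lamCol hG hx hx1 hx0 hψ hw b).wirt_neg_e
  injective w hw := Function.LeftInverse.injective
    (g := fun u => fderiv ℝ (prodLaw x ψ ψ) (0, w) (u, 0))
    (fderiv_prodLaw_frameMap hG hx hx1 hx0 hψ hw)
  surjective w hw := Function.RightInverse.surjective
    (g := fun u => fderiv ℝ (prodLaw x ψ ψ) (0, w) (u, 0))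
    (frameMap_fderiv_prodLaw hG hx hx1 hx0 hψ hw)
  antisymm u v := by
    rw [bracket_eq_mixed hG hx hx1 hx0, bracket_eq_mixed hG hx hx1 hx0, neg_sub]

end Group

section Curvature

variable {m : ℕ}
  {E : Type*} [NormedAddCommGroup E] [NormedSpace ℝ E]
  {G : Type*} [TopologicalSpace G] [ChartedSpace E G] [IsManifold 𝓘(ℝ, E) ∞ G] [Group G]
  {J : EndField 𝓘(ℝ, E) G} {x x' ψ : OpenPartialHomeomorph G (PCn m)}

theorem frameMap_lamCol_eq_mulVec (w u : PCn m) :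
    frameMap (lamCol x ψ) w u = (lam x ψ w).mulVec u := by
  ext1 a
  simp [frameMap_apply, Matrix.mulVec, dotProduct, lamCol, mul_comm]

/-! ### The Killing form and the sectional curvature -/

/-- The Killing form `C_{ab} u^a v^b`. -/
def killingForm (x : OpenPartialHomeomorph G (PCn m)) : PCn m →ₗ[PC] PCn m →ₗ[PC] PC :=
  ((LinearMap.mul PC (Module.End PC (PCn m))).compl₁₂ (bracket x) (bracket x)).compr₂
    (LinearMap.trace PC (PCn m))

theorem killingForm_apply (x : OpenPartialHomeomorph G (PCn m)) (u v : PCn m) :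
    killingForm x u v = LinearMap.trace PC (PCn m) (bracket x u ∘ₗ bracket x v) := rfl

/-- The matrix of $[u,\cdot]$ has entries $C^c_{pd}u^p$, and $C_{ab}$ is the trace of a product of
two such matrices. The trace form makes the invariance under linear isomorphisms available. -/
theorem killingForm_eq_sum (x : OpenPartialHomeomorph G (PCn m)) (u v : PCn m) :
    killingForm x u v = ∑ p, ∑ q, killing x p q * u p * v q := by
  have had : ∀ u, bracket x u =
      Matrix.toLin' (Matrix.of fun c d => ∑ p, structConst x c p d * u p) := by
    intro u
    refine LinearMap.ext fun v => funext fun c => ?_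
    rw [bracket_apply, Matrix.toLin'_apply, Finset.sum_comm]
    simp [Matrix.mulVec, dotProduct, Finset.sum_mul]
  rw [killingForm_apply, had, had, ← Matrix.toLin'_mul, Matrix.trace_toLin'_eq]
  simp only [Matrix.trace, Matrix.diag, Matrix.mul_apply, Matrix.of_apply, killing,
    Finset.sum_mul, Finset.mul_sum]
  rw [Finset.sum_congr rfl fun c _ => Finset.sum_congr rfl fun d _ => Finset.sum_comm]
  rw [Finset.sum_congr rfl fun c _ => Finset.sum_comm, Finset.sum_comm]
  refine Finset.sum_congr rfl fun p _ => ?_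
  rw [Finset.sum_congr rfl fun c _ => Finset.sum_comm, Finset.sum_comm]
  refine Finset.sum_congr rfl fun q _ => Finset.sum_congr rfl fun c _ =>
    Finset.sum_congr rfl fun d _ => by ring

theorem metric_eq (a b : Fin m) (w : PCn m) :
    metric x ψ a b w = killingForm x (lamCol x ψ a w) (lamCol x ψ b w) :=
  (killingForm_eq_sum x _ _).symm

theorem sum_metric (w Z W : PCn m) : ∑ a, ∑ b, metric x ψ a b w * Z a * W b =
    killingForm x (frameMap (lamCol x ψ) w Z) (frameMap (lamCol x ψ) w W) := by
  simp only [metric_eq, frameMap_apply, map_sum, LinearMap.sum_apply, map_smul,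
    LinearMap.smul_apply, smul_eq_mul]
  rw [Finset.sum_comm]
  refine Finset.sum_congr rfl fun b _ => ?_
  rw [Finset.mul_sum]
  exact Finset.sum_congr rfl fun a _ => by ring

/-- The numerator of the sectional curvature of the right-invariant fields with the values `u` and
`v` at the identity. -/
def curvatureNumerator (x : OpenPartialHomeomorph G (PCn m)) (u v : PCn m) : PC :=
  killingForm x v ((1 / 4 : ℝ) • bracket x u (bracket x u v))

/-- The denominator of the sectional curvature of the right-invariant fields with the values `u` and
`v` at the identity. -/
def curvatureDenominator (x : OpenPartialHomeomorph G (PCn m)) (u v : PCn m) : PC :=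
  killingForm x u u * killingForm x v v - killingForm x u v * killingForm x v u

theorem planeForm_eq (w Z W : PCn m) : planeForm x ψ w Z W =
    curvatureDenominator x (frameMap (lamCol x ψ) w Z) (frameMap (lamCol x ψ) w W) := by
  have h1 : ∀ Z W Z' W' : PCn m, (∑ a, ∑ c, metric x ψ a c w * Z a * W c) *
      (∑ b, ∑ d, metric x ψ b d w * Z' b * W' d) = ∑ a, ∑ b, ∑ c, ∑ d,
        (metric x ψ a c w * Z a * W c) * (metric x ψ b d w * Z' b * W' d) := by
    intro Z W Z' W'
    rw [Finset.sum_mul_sum]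
    exact Finset.sum_congr rfl fun a _ => Finset.sum_congr rfl fun b _ => Finset.sum_mul_sum _ _ _ _
  have h2 := h1 Z Z W W
  have h3 := h1 Z W W Z
  rw [Finset.sum_congr rfl fun a _ => Finset.sum_congr rfl fun b _ => Finset.sum_comm] at h3
  rw [curvatureDenominator, ← sum_metric, ← sum_metric, ← sum_metric, ← sum_metric, h2, h3]
  simp only [planeForm, ← Finset.sum_sub_distrib]
  exact Finset.sum_congr rfl fun a _ => Finset.sum_congr rfl fun b _ => Finset.sum_congr rfl
    fun c _ => Finset.sum_congr rfl fun d _ => by ring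

/-! ### The canonical connection and its curvature -/

/-- The vector `(Γ^k_{bc})_k`. -/
def gamVec (x ψ : OpenPartialHomeomorph G (PCn m)) (b c : Fin m) (w : PCn m) : PCn m :=
  fun k => Gam x ψ k b c w

variable (hG : IsParaComplexLieGroup J) (hx : IsParaHolChart J x) (hx1 : 1 ∈ x.source)
  (hx0 : x 1 = 0)
include hG hx hx1 hx0

section InChart

variable (hψ : IsParaHolChart J ψ) {w : PCn m} (hw : w ∈ ψ.target)
include hψ hw

/-- Exhibits the entries of $\widetilde\lambda$ as derivatives of a smooth map, from which the
smoothness of $\Gamma$ follows without a study of matrix inversion over $C$. -/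
theorem lam_inv_apply (a d : Fin m) :
    (lam x ψ w)⁻¹ a d = fderiv ℝ (prodLaw x ψ ψ) (0, w) (Pi.single d 1, 0) a := by
  have h : lam x ψ w * Matrix.of (fun a d =>
      fderiv ℝ (prodLaw x ψ ψ) (0, w) (Pi.single d 1, 0) a) = 1 := by
    ext1 i d
    have := congrFun (frameMap_fderiv_prodLaw hG hx hx1 hx0 hψ hw (Pi.single d 1)) i
    rw [frameMap_lamCol_eq_mulVec] at this
    rw [Matrix.one_apply, ← Pi.single_apply, ← this]
    rfl
  rw [Matrix.inv_eq_right_inv h]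
  rfl

theorem lam_mul_inv : lam x ψ w * (lam x ψ w)⁻¹ = 1 := by
  ext1 i d
  have := congrFun (frameMap_fderiv_prodLaw hG hx hx1 hx0 hψ hw (Pi.single d 1)) i
  rw [frameMap_lamCol_eq_mulVec] at this
  rw [Matrix.one_apply, ← Pi.single_apply, ← this]
  simp only [Matrix.mul_apply, lam_inv_apply hG hx hx1 hx0 hψ hw]
  rfl

theorem dz_lam (b c d : Fin m) :
    dz (fun u => lam x ψ u d b) c w = wirt e (lamCol x ψ b) c w d :=
  (wirt_apply (pholAt_lamCol hG hx hx1 hx0 hψ hw b).differentiableAt d).symm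

theorem gamVec_eq (b c : Fin m) :
    gamVec x ψ b c w = ∑ d, (wirt e (lamCol x ψ b) c w + (1 / 2 : ℝ) •
      bracket x (lamCol x ψ b w) (lamCol x ψ c w)) d •
        fderiv ℝ (prodLaw x ψ ψ) (0, w) (Pi.single d 1, 0) := by
  ext1 a
  simp only [gamVec, Gam, Finset.sum_apply, Pi.smul_apply, smul_eq_mul, Pi.add_apply,
    dz_lam hG hx hx1 hx0 hψ hw, lam_inv_apply hG hx hx1 hx0 hψ hw]
  exact Finset.sum_congr rfl fun d _ => mul_comm _ _

theorem frameMap_gamVec (b c : Fin m) :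
    frameMap (lamCol x ψ) w (gamVec x ψ b c w) = wirt e (lamCol x ψ b) c w + (1 / 2 : ℝ) •
      bracket x (lamCol x ψ b w) (lamCol x ψ c w) := by
  have h : gamVec x ψ b c w = (lam x ψ w)⁻¹.mulVec (wirt e (lamCol x ψ b) c w + (1 / 2 : ℝ) •
      bracket x (lamCol x ψ b w) (lamCol x ψ c w)) := by
    ext1 a
    simp only [gamVec, Gam, dz_lam hG hx hx1 hx0 hψ hw]
    rfl
  rw [frameMap_lamCol_eq_mulVec, h, Matrix.mulVec_mulVec, lam_mul_inv hG hx hx1 hx0 hψ hw,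
    Matrix.one_mulVec]

/-- Before $\widetilde\lambda$ is applied, the two expressions differ by half of the Maurer–Cartan
equation. -/
theorem Gam_eq_GamSymm (a b c : Fin m) : Gam x ψ a b c w = GamSymm x ψ a b c w := by
  have h := maurerCartan_lamCol hG hx hx1 hx0 hψ hw b c
  rw [Gam, GamSymm, Finset.smul_sum]
  simp only [dz_lam hG hx hx1 hx0 hψ hw]
  refine Finset.sum_congr rfl fun d _ => ?_
  rw [← mul_smul_comm]
  congr 1
  have hd := congrFun h d
  simp only [Pi.sub_apply, Pi.neg_apply, bracket_apply, lamCol] at hd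
  linear_combination (norm := module) (1 / 2 : ℝ) • hd

end InChart

theorem isConnection_gamVec (hψ : IsParaHolChart J ψ) :
    IsConnection ψ.target (bracket x) (lamCol x ψ) (gamVec x ψ) where
  frameMap_eq w hw := frameMap_gamVec hG hx hx1 hx0 hψ hw
  smooth w hw b c := by
    have hev : gamVec x ψ b c =ᶠ[nhds w] fun w => ∑ d, (wirt e (lamCol x ψ b) c w +
        (1 / 2 : ℝ) • bracket x (lamCol x ψ b w) (lamCol x ψ c w)) d •
          fderiv ℝ (prodLaw x ψ ψ) (0, w) (Pi.single d 1, 0) := by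
      filter_upwards [ψ.open_target.mem_nhds hw] with y hy
      exact gamVec_eq hG hx hx1 hx0 hψ hy b c
    refine ContDiffAt.congr_of_eventuallyEq (ContDiffAt.sum fun d _ => ?_) hev
    have hs := fun b => (pholAt_lamCol hG hx hx1 hx0 hψ hw b).smooth
    have h1 : ContDiffAt ℝ ∞ (fun w => wirt e (lamCol x ψ b) c w +
        (1 / 2 : ℝ) • bracket x (lamCol x ψ b w) (lamCol x ψ c w)) w :=
      (contDiffAt_wirt (hs b) c).add ((contDiffAt_bilin (bracket x) (hs b) (hs c)).const_smul _)
    refine contDiffAt_pc_smul (contDiffAt_component h1 d) ?_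
    exact ContDiffAt.comp (f := fun y : PCn m => ((0 : PCn m), y)) w (contDiffAt_fderiv_apply
      (eventually_prodLaw_left hG hx hx1 hx0 hψ hw).self_of_nhds.2.smooth _)
      (contDiffAt_const.prodMk contDiffAt_id)

section InChart

variable (hψ : IsParaHolChart J ψ) {w : PCn m} (hw : w ∈ ψ.target)
include hψ hw

theorem curv_eq (d c a b : Fin m) : curv x ψ d c a b w = curvVec (gamVec x ψ) c a b w d := by
  have hs := fun b c => ((isConnection_gamVec hG hx hx1 hx0 hψ).smooth w hw b c).differentiableAt
    ne_infty
  simp only [curvVec, Pi.add_apply, Pi.sub_apply, wirt_apply (hs _ _), Finset.sum_apply,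
    Pi.smul_apply, smul_eq_mul]
  rfl

theorem curv_eventuallyEq (d c a b : Fin m) :
    curv x ψ d c a b =ᶠ[nhds w] fun u => curvVec (gamVec x ψ) c a b u d := by
  filter_upwards [ψ.open_target.mem_nhds hw] with y hy
  exact curv_eq hG hx hx1 hx0 hψ hy d c a b

theorem covDerivCurv_eq_zero (f d c a b : Fin m) : covDerivCurv x ψ f d c a b w = 0 := by
  have hL := isCoframe_lamCol hG hx hx1 hx0 hψ
  have hΓ := isConnection_gamVec hG hx hx1 hx0 hψ
  have h := congrFun (hL.covDeriv_curvVec hw hΓ f c a b) d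
  rw [Pi.add_apply, wirt_apply ((hL.contDiffAt_curvVec hw hΓ c a b).differentiableAt ne_infty),
    ← wirt_congr (curv_eventuallyEq hG hx hx1 hx0 hψ hw d c a b)] at h
  rw [covDerivCurv, dz_eq_wirt]
  simp only [curv_eq hG hx hx1 hx0 hψ hw]
  refine Eq.trans ?_ h
  congr 1
  rw [Finset.sum_apply]
  refine Finset.sum_congr rfl fun k _ => ?_
  simp only [Pi.sub_apply, Pi.smul_apply, smul_eq_mul, gamVec]
  ring

theorem covDerivBarCurv_eq_zero (f d c a b : Fin m) : covDerivBarCurv x ψ f d c a b w = 0 := by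
  have hL := isCoframe_lamCol hG hx hx1 hx0 hψ
  have hΓ := isConnection_gamVec hG hx hx1 hx0 hψ
  have h := congrFun (hL.wirt_bar_curvVec hw hΓ f c a b) d
  rw [wirt_apply ((hL.contDiffAt_curvVec hw hΓ c a b).differentiableAt ne_infty),
    ← wirt_congr (curv_eventuallyEq hG hx hx1 hx0 hψ hw d c a b)] at h
  rw [covDerivBarCurv, dzbar_eq_wirt, h]
  rfl

end InChart

theorem curvForm_eq (hψ : IsParaHolChart J ψ) {w : PCn m} (hw : w ∈ ψ.target) (Z W : PCn m) :
    curvForm x ψ w Z W =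
      curvatureNumerator x (frameMap (lamCol x ψ) w Z) (frameMap (lamCol x ψ) w W) := by
  have hL := isCoframe_lamCol hG hx hx1 hx0 hψ
  have hΓ := isConnection_gamVec hG hx hx1 hx0 hψ
  -- This is the vector $R(Z,W)Z$. Its frame image is $\frac14[\zeta,[\zeta,\omega]]$ with
  -- $\zeta=\lambda(Z)$, $\omega=\lambda(W)$, and `curvForm` pairs it with $W$.
  let R : PCn m := ∑ a, ∑ b, ∑ c, (Z a * Z c * W b) • curvVec (gamVec x ψ) c a b w
  have hR : frameMap (lamCol x ψ) w R = (1 / 4 : ℝ) • bracket x (frameMap (lamCol x ψ) w Z)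
      (bracket x (frameMap (lamCol x ψ) w Z) (frameMap (lamCol x ψ) w W)) := by
    simp only [R, map_sum, map_smul, hL.frameMap_curvVec hw hΓ]
    simp only [frameMap_apply, map_sum, LinearMap.sum_apply, map_smul, LinearMap.smul_apply,
      Finset.smul_sum]
    rw [Finset.sum_comm]
    refine Finset.sum_congr rfl fun b _ => Finset.sum_congr rfl fun a _ =>
      Finset.sum_congr rfl fun c _ => ?_
    simp only [smul_smul, smul_comm _ (1 / 4 : ℝ)]
    congr 2
    ring
  rw [curvatureNumerator, ← hR, ← sum_metric]
  have hRf : ∀ f, R f = ∑ a, ∑ b, ∑ c, (Z a * Z c * W b) * curv x ψ f c a b w := fun f => by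
    simp only [R, Finset.sum_apply, Pi.smul_apply, smul_eq_mul, curv_eq hG hx hx1 hx0 hψ hw]
  have h1 : curvForm x ψ w Z W = ∑ a, ∑ b, ∑ c, ∑ d, ∑ f,
      metric x ψ d f w * W d * ((Z a * Z c * W b) * curv x ψ f c a b w) := by
    simp only [curvForm, curv4, Finset.sum_mul]
    exact Finset.sum_congr rfl fun a _ => Finset.sum_congr rfl fun b _ => Finset.sum_congr rfl
      fun c _ => Finset.sum_congr rfl fun d _ => Finset.sum_congr rfl fun f _ => by ring
  simp only [h1, hRf, Finset.mul_sum]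
  rw [Finset.sum_congr rfl fun a _ => Finset.sum_congr rfl fun b _ => Finset.sum_comm,
    Finset.sum_congr rfl fun a _ => Finset.sum_comm, Finset.sum_comm]
  refine Finset.sum_congr rfl fun d _ => ?_
  rw [Finset.sum_congr rfl fun a _ => Finset.sum_congr rfl fun b _ => Finset.sum_comm,
    Finset.sum_congr rfl fun a _ => Finset.sum_comm, Finset.sum_comm]

/-! ### Change of the coordinates at the identity -/

section ChangeOfCoordinates

variable (hx' : IsParaHolChart J x') (hx1' : 1 ∈ x'.source) (hx0' : x' 1 = 0)
include hx' hx1' hx0'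

/-- Chain rule for $x'(qp^{-1})=(x'\circ x^{-1})(x(qp^{-1}))$. The transition factor is
differentiated at $0$ whatever $w$ is, so the two coframes differ by a constant matrix. -/
theorem frameMap_change (hψ : IsParaHolChart J ψ) {w : PCn m} (hw : w ∈ ψ.target) (u : PCn m) :
    frameMap (lamCol x' ψ) w u =
      frameMap (lamCol x' x) 0 (frameMap (lamCol x ψ) w u) := by
  have h0 := zero_mem_target hx1 hx0
  have hq := pholAt_quot hG hx hx1 hx0 hψ hw
  have hq' := pholAt_quot hG hx' hx1' hx0' hx h0
  have hq0 : quot x ψ (w, w) = 0 := quot_diag hG hx hx1 hx0 hψ hw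
  rw [frameMap_lamCol hG hx' hx1' hx0' hψ hw, frameMap_lamCol hG hx hx1 hx0 hψ hw,
    frameMap_lamCol hG hx' hx1' hx0' hx h0]
  have hev : (fun y => quot x' ψ (y, w)) =ᶠ[nhds w]
      fun y => quot x' x (quot x ψ (y, w), 0) := by
    filter_upwards [(Continuous.tendsto (by fun_prop : Continuous fun y : PCn m => (y, w)) w).eventually
      (eventually_quot_diag hG hx hx1 hx0 hψ hw)] with y h1
    simp [quot, x.left_inv h1.1, symm_zero hx1 hx0]
  have h3 : DifferentiableAt ℝ (fun y => quot x' x (y, 0)) (quot x ψ (w, w)) := by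
    rw [hq0]; exact hq'.left.differentiableAt
  have h4 := fderiv_fun_comp (g := fun y => quot x' x (y, 0))
    (f := fun y => quot x ψ (y, w)) w h3 hq.left.differentiableAt
  rw [hev.fderiv_eq, h4, hq0]
  rfl

theorem frameMap_self (u : PCn m) : frameMap (lamCol x x) 0 u = u := by
  have h0 := zero_mem_target hx1 hx0
  rw [frameMap_lamCol hG hx hx1 hx0 hx h0]
  have hev : (fun y => quot x x (y, 0)) =ᶠ[nhds 0] fun y => y := by
    filter_upwards [x.open_target.mem_nhds h0] with y h1
    simp [quot, symm_zero hx1 hx0, x.right_inv h1]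
  rw [hev.fderiv_eq]
  simp

/-- Both coframes satisfy Maurer–Cartan in the same chart $x$ and differ by the constant map `P`.
Applying `P` to one equation at the origin and comparing it with the other identifies the brackets
on basis vectors, where the coframe of $x$ itself is the identity. -/
theorem bracket_change (u v : PCn m) :
    bracket x' (frameMap (lamCol x' x) 0 u) (frameMap (lamCol x' x) 0 v) =
      frameMap (lamCol x' x) 0 (bracket x u v) := by
  have h0 := zero_mem_target hx1 hx0
  let P := frameMap (lamCol x' x) 0
  have hcol : ∀ (y : OpenPartialHomeomorph G (PCn m)) b w,
      lamCol y x b w = frameMap (lamCol y x) w (Pi.single b 1) := fun y b w => by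
    rw [frameMap_apply, Finset.sum_eq_single b] <;> simp +contextual
  have hP : ∀ b, lamCol x' x b =ᶠ[nhds 0] fun w => P (lamCol x x b w) := by
    intro b
    filter_upwards [x.open_target.mem_nhds h0] with w hw
    rw [hcol, hcol, frameMap_change hG hx hx1 hx0 hx' hx1' hx0' hx hw]
  have hlin : ∀ b c, wirt e (lamCol x' x b) c 0 = P (wirt e (lamCol x x b) c 0) := by
    intro b c
    have hd := pholAt_lamCol hG hx hx1 hx0 hx h0 b
    have hd' := pholAt_lamCol hG hx' hx1' hx0' hx h0 b
    have := (((P.restrictScalars ℝ).toContinuousLinearMap).hasFDerivAt.comp 0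
      hd.differentiableAt.hasFDerivAt).fderiv
    rw [hd.wirt_e, hd'.wirt_e, (hP b).fderiv_eq]
    exact congrArg (fun A : PCn m →L[ℝ] PCn m => A _) this
  have hsingle : ∀ b c : Fin m, bracket x' (P (Pi.single b 1)) (P (Pi.single c 1)) =
      P (bracket x (Pi.single b 1) (Pi.single c 1)) := by
    intro b c
    have h1 := maurerCartan_lamCol hG hx' hx1' hx0' hx h0 b c
    have h2 := congrArg P (maurerCartan_lamCol hG hx hx1 hx0 hx h0 b c)
    rw [hlin, hlin, ← map_sub, h2, map_neg, neg_inj, hcol x, hcol x,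
      frameMap_self hG hx hx1 hx0 hx' hx1' hx0', frameMap_self hG hx hx1 hx0 hx' hx1' hx0',
      hcol x', hcol x'] at h1
    exact h1.symm
  have hext : (bracket x').compl₁₂ P P = (bracket x).compr₂ P :=
    (Pi.basisFun PC (Fin m)).ext fun b => (Pi.basisFun PC (Fin m)).ext fun c => by
      simpa using hsingle b c
  exact congrArg (fun A : PCn m →ₗ[PC] PCn m →ₗ[PC] PCn m => A u v) hext

/-- Intertwining the brackets means that the adjoint maps are conjugate, and the trace is invariant
under conjugation. -/
theorem killingForm_change (u v : PCn m) :
    killingForm x' (frameMap (lamCol x' x) 0 u) (frameMap (lamCol x' x) 0 v) =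
      killingForm x u v := by
  have hL := isCoframe_lamCol hG hx' hx1' hx0' hx
  have h0 := zero_mem_target hx1 hx0
  let P : PCn m ≃ₗ[PC] PCn m := LinearEquiv.ofBijective (frameMap (lamCol x' x) 0)
    ⟨hL.injective 0 h0, hL.surjective 0 h0⟩
  have had : ∀ u, bracket x' (P u) = P.conj (bracket x u) := by
    intro u
    refine LinearMap.ext fun v => ?_
    obtain ⟨v, rfl⟩ := P.surjective v
    rw [LinearEquiv.conj_apply_apply, P.symm_apply_apply]
    exact bracket_change hG hx hx1 hx0 hx' hx1' hx0' u v
  change killingForm x' (P u) (P v) = _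
  rw [killingForm_apply, killingForm_apply, had, had, ← LinearEquiv.conj_comp,
    LinearMap.trace_conj']

theorem curvatureNumerator_change (u v : PCn m) :
    curvatureNumerator x' (frameMap (lamCol x' x) 0 u) (frameMap (lamCol x' x) 0 v) =
      curvatureNumerator x u v := by
  simp only [curvatureNumerator, bracket_change hG hx hx1 hx0 hx' hx1' hx0',
    ← LinearMap.map_smul_of_tower, killingForm_change hG hx hx1 hx0 hx' hx1' hx0']

theorem curvatureDenominator_change (u v : PCn m) :
    curvatureDenominator x' (frameMap (lamCol x' x) 0 u) (frameMap (lamCol x' x) 0 v) =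
      curvatureDenominator x u v := by
  simp only [curvatureDenominator, killingForm_change hG hx hx1 hx0 hx' hx1' hx0']

end ChangeOfCoordinates

/-! ### Right-invariant fields -/

/-- The frame at $p$ is the coordinate form of the differential of right translation by $p^{-1}$,
which carries $Z(p)$ to $Z(1)$. -/
theorem frameMap_components (hψ : IsParaHolChart J ψ) {Z : ∀ p : G, TC (E := E) p}
    (hZ : IsRightInvariant Z) {p : G} (hp : p ∈ ψ.source) :
    frameMap (lamCol x ψ) (ψ p) (components ψ (Z p)) = components x (Z 1) := by
  have hw := ψ.map_source hp
  have hq := pholAt_quot hG hx hx1 hx0 hψ hw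
  have h1 : components x (Z 1) = components x (Z (p * p⁻¹)) :=
    congrArg (fun q => components x (Z q)) (mul_inv_cancel p).symm
  rw [h1, ← hZ p p⁻¹]
  have hR : MDifferentiableAt 𝓘(ℝ, E) 𝓘(ℝ, E) (fun q : G => q * p⁻¹) p := by
    have hm : ContMDiffAt (𝓘(ℝ, E).prod 𝓘(ℝ, E)) 𝓘(ℝ, E) ∞ (fun p : G × G => p.1 * p.2)
      (p, p⁻¹) := hG.mul.smooth.contMDiffAt Filter.univ_mem
    exact (hm.comp (f := fun q : G => (q, p⁻¹)) p
      (contMDiffAt_id.prodMk contMDiffAt_const)).mdifferentiableAt ne_infty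
  have hsrc : p * p⁻¹ ∈ x.source := by simpa using hx1
  have hxd : MDifferentiableAt 𝓘(ℝ, E) 𝓘(ℝ, PCn m) x (p * p⁻¹) :=
    (hx.toFun.smooth.contMDiffAt (x.open_source.mem_nhds hsrc)).mdifferentiableAt ne_infty
  have hψd : MDifferentiableAt 𝓘(ℝ, E) 𝓘(ℝ, PCn m) ψ p :=
    (hψ.toFun.smooth.contMDiffAt (ψ.open_source.mem_nhds hp)).mdifferentiableAt ne_infty
  have hchain : ∀ v : TangentSpace 𝓘(ℝ, E) p,
      (mfderiv 𝓘(ℝ, E) 𝓘(ℝ, PCn m) x (p * p⁻¹)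
        (mfderiv 𝓘(ℝ, E) 𝓘(ℝ, E) (fun q : G => q * p⁻¹) p v) : PCn m) =
      frameMap (lamCol x ψ) (ψ p) (mfderiv 𝓘(ℝ, E) 𝓘(ℝ, PCn m) ψ p v : PCn m) := by
    intro v
    have hev : (x ∘ fun q : G => q * p⁻¹) =ᶠ[nhds p] (fun y => quot x ψ (y, ψ p)) ∘ ψ := by
      filter_upwards [ψ.open_source.mem_nhds hp] with q hq
      simp [quot, ψ.left_inv hq, ψ.left_inv hp]
    have c1 := mfderiv_comp p hxd hR
    have c2 := mfderiv_comp p hq.left.differentiableAt.mdifferentiableAt hψd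
    rw [hev.mfderiv_eq, c2, mfderiv_eq_fderiv] at c1
    refine Eq.trans ?_ (frameMap_lamCol hG hx hx1 hx0 hψ hw (mfderiv 𝓘(ℝ, E) 𝓘(ℝ, PCn m) ψ p v)).symm
    exact (congrArg (fun A : E →L[ℝ] PCn m => A v) c1).symm
  ext1 a
  simp only [frameMap_apply, Finset.sum_apply, Pi.smul_apply, smul_eq_mul, components]
  -- `hchain` concerns real tangent vectors; both sides are additive and para-complex homogeneous,
  -- so pure tensors suffice.
  induction Z p using TensorProduct.induction_on with
  | zero => simp
  | add s t hs ht => simp only [map_add, add_mul, Finset.sum_add_distrib, hs, ht]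
  | tmul z v =>
    have h2 := congrFun ((hchain v).trans
      (frameMap_apply _ _ (mfderiv 𝓘(ℝ, E) 𝓘(ℝ, PCn m) ψ p v))) a
    rw [Finset.sum_apply] at h2
    simp only [LinearMap.baseChange_tmul, LinearMap.liftBaseChange_tmul]
    refine Eq.trans ?_ (congrArg (fun t : PC => z • t) h2.symm)
    rw [Finset.smul_sum]
    refine Finset.sum_congr rfl fun k _ => ?_
    simp only [smul_eq_mul, Pi.smul_apply]
    exact mul_assoc _ _ _

end Curvature

end ParaHol

end

theorem mainTheorem12
    {E : Type*} [NormedAddCommGroup E] [NormedSpace ℝ E] [FiniteDimensional ℝ E]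
    {G : Type*} [TopologicalSpace G] [ChartedSpace E G] [IsManifold 𝓘(ℝ, E) ∞ G] [Group G]
    (J : ParaHol.EndField 𝓘(ℝ, E) G) (hG : ParaHol.IsParaComplexLieGroup J)
    (m : ℕ) (hm : Module.finrank ℝ E = 2 * m) :
    -- the two expressions of the connection coefficients agree
    (∀ x ψ : OpenPartialHomeomorph G (ParaHol.PCn m),
      ParaHol.IsParaHolChart J x → 1 ∈ x.source → x 1 = 0 → ParaHol.IsParaHolChart J ψ →
      ∀ w ∈ ψ.target, ∀ a b c, ParaHol.Gam x ψ a b c w = ParaHol.GamSymm x ψ a b c w) ∧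
    -- the sectional curvature of a pair of right-invariant vector fields is constant
    (∀ Z W : ∀ p : G, ParaHol.TC (E := E) p,
      ParaHol.IsParaHolVectorField m J Z → ParaHol.IsRightInvariant Z →
      ParaHol.IsParaHolVectorField m J W → ParaHol.IsRightInvariant W →
      (∃ x ψ : OpenPartialHomeomorph G (ParaHol.PCn m), ∃ p : G,
        ParaHol.IsParaHolChart J x ∧ 1 ∈ x.source ∧ x 1 = 0 ∧ ParaHol.IsParaHolChart J ψ ∧
        p ∈ ψ.source ∧ ParaHol.IsNondegenerateAt x ψ Z W p) →
      ∃ k : ParaHol.PC, ∀ x ψ : OpenPartialHomeomorph G (ParaHol.PCn m),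
        ParaHol.IsParaHolChart J x → 1 ∈ x.source → x 1 = 0 → ParaHol.IsParaHolChart J ψ →
        ∀ p ∈ ψ.source, ParaHol.IsNondegenerateAt x ψ Z W p ∧
          ParaHol.IsSectionalCurvatureAt x ψ Z W p k) ∧
    -- the curvature is covariantly constant
    (∀ x ψ : OpenPartialHomeomorph G (ParaHol.PCn m),
      ParaHol.IsParaHolChart J x → 1 ∈ x.source → x 1 = 0 → ParaHol.IsParaHolChart J ψ →
      ∀ w ∈ ψ.target, ∀ f d c a b, ParaHol.covDerivCurv x ψ f d c a b w = 0 ∧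
        ParaHol.covDerivBarCurv x ψ f d c a b w = 0) := by
  refine ⟨fun x ψ hx hx1 hx0 hψ w hw a b c => ParaHol.Gam_eq_GamSymm hG hx hx1 hx0 hψ hw a b c,
    fun Z W _ hZ _ hW => ?_, fun x ψ hx hx1 hx0 hψ w hw f d c a b =>
      ⟨ParaHol.covDerivCurv_eq_zero hG hx hx1 hx0 hψ hw f d c a b,
        ParaHol.covDerivBarCurv_eq_zero hG hx hx1 hx0 hψ hw f d c a b⟩⟩
  rintro ⟨x, ψ, p, hx, hx1, hx0, hψ, hp, hnd⟩
  rw [ParaHol.IsNondegenerateAt, ParaHol.planeForm_eq,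
    ParaHol.frameMap_components hG hx hx1 hx0 hψ hZ hp,
    ParaHol.frameMap_components hG hx hx1 hx0 hψ hW hp] at hnd
  obtain ⟨D, hD⟩ := hnd
  -- The constant is numerator over denominator at the identity in the given chart. Invertibility of
  -- the denominator, not just its being nonzero, is what permits the division in $C$.
  refine ⟨ParaHol.curvatureNumerator x (ParaHol.components x (Z 1)) (ParaHol.components x (W 1)) *
    ((D⁻¹ : ParaHol.PCˣ) : ParaHol.PC), fun x' ψ' hx' hx1' hx0' hψ' p' hp' => ?_⟩
  -- Taking $x$ as the chart and $1$ as the point shows that the components at the identity in $x'$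
  -- are those in $x$ transported by the change-of-coframe map.
  have hZ' := ParaHol.frameMap_components hG hx' hx1' hx0' hx hZ hx1
  have hW' := ParaHol.frameMap_components hG hx' hx1' hx0' hx hW hx1
  rw [hx0] at hZ' hW'
  rw [ParaHol.IsNondegenerateAt, ParaHol.IsSectionalCurvatureAt, ParaHol.planeForm_eq,
    ParaHol.curvForm_eq hG hx' hx1' hx0' hψ' (ψ'.map_source hp'),
    ParaHol.frameMap_components hG hx' hx1' hx0' hψ' hZ hp',
    ParaHol.frameMap_components hG hx' hx1' hx0' hψ' hW hp', ← hZ', ← hW',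
    ParaHol.curvatureNumerator_change hG hx hx1 hx0 hx' hx1' hx0',
    ParaHol.curvatureDenominator_change hG hx hx1 hx0 hx' hx1' hx0', ← hD]
  exact ⟨D.isUnit, by rw [mul_assoc, Units.inv_mul, mul_one]⟩
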